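/- **Setting.** Let $(x_i,d_i)\in\mathcal X\times\{0,1\}$, $i=1,\dots,n$, be fixed (for instance $\mathcal X=\mathbb R^p$), let $\sigma^2(\cdot,\cdot)$ be a known function that is positive at the points $(x_i,d_i)$, and let $w_1,\dots,w_n$ be known weights with $\sum_i w_i=1$. Under $f:\mathcal X\times\{0,1\}\to\mathbb R$ the outcomes $y_i\sim N(f(x_i,d_i),\sigma^2(x_i,d_i))$ are independent; $P_f,E_f$ denote probability and expectation. The function $f$ is known to lie in a class $\mathcal F$, and the parameter of interest is $Lf=\sum_i w_i\,(f(x_i,1)-f(x_i,0))$. An affine estimator is $\hat L=a+\sum_i k_iy_i$ with constants $a,k_i$; put $\mathrm{sd}(\hat L)=(\sum_i k_i^2\sigma^2(x_i,d_i))^{1/2}$, $\overline{\mathrm{bias}}(\hat L)=\sup_{f\in\mathcal F}E_f(\hat L-Lf)$ and $R(\hat L)=(\sup_{f\in\mathcal F}E_f(\hat L-Lf)^2)^{1/2}$ (worst-case RMSE). A random set $\mathcal C$ is a $1-\alpha$ CI if $\inf_{f\in\mathcal F}P_f(Lf\in\mathcal C)\ge1-\alpha$. For a one-sided CI $[\hat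 c,\infty)$ let $q_\beta(\hat c,\mathcal F)$ be the supremum over $g\in\mathcal F$ of the $\beta$-quantile of the excess length $Lg-\hat c$ under $P_g$. A fixed-length CI (FLCI) centered at an affine estimator is $[\hat L-\chi,\hat L+\chi]$ with constant $\chi$. Let $z_p$ and $\Phi$ be the $p$-quantile and the cdf of $N(0,1)$, and $\mathrm{cv}_\alpha(b)$ the $1-\alpha$ quantile of $|N(b,1)|$; for $s=0$, $\mathrm{cv}_\alpha(b/s)\,s$ denotes its limit $|b|$ as $s\downarrow 0$. Let $\|h\|_\sigma^2=\sum_i h(x_i,d_i)^2/\sigma^2(x_i,d_i)$ and, for $\delta\ge0$, $$\omega(\delta)=\sup\{Lg-Lf:\ f,g\in\mathcal F,\ \|f-g\|_\sigma\le\delta\},$$ and let $\partial\omega(\delta)$ be the superdifferential of $\omega:[0,\infty)\to\mathbb R$ at $\delta$. Given $\delta>0$, $s\in\partial\omega(\delta)$ and a pair $f^*,g^*\in\mathcal F$ that attains the supremum in $\omega(\delta)$ (in particular, $\omega(\delta)$ is finite), let $$\hat L_{\delta,s}=a^*+\sum_i k_i^*y_i,\quad k_i^*=\frac{s}{\delta}\,\frac{g^*(x_i,d_i)-f^*(x_i,d_i)}{\sigma^2(x_i,d_i)},\quad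 a^*=\tfrac12\Big[L(f^*+g^*)-\sum_ik^*_i\big(f^*(x_i,d_i)+g^*(x_i,d_i)\big)\Big].$$ (If $\omega$ is differentiable at $\delta$, then $s=\omega'(\delta)$ is the only choice.) **Theorem.** Let $\mathcal F$ be convex and $0<\alpha<1$. In each part, $\delta>0$, $s\in\partial\omega(\delta)$, and $f^*,g^*$ is any pair that attains $\omega(\delta)$; $\overline{\mathrm{bias}}(\hat L_{\delta,s})$ is finite in (i) and (ii). (i) Suppose $\|f^*-g^*\|_\sigma=\delta$, and let $\hat c^*=\hat L_{\delta,s}-\overline{\mathrm{bias}}(\hat L_{\delta,s})-z_{1-\alpha}\,\mathrm{sd}(\hat L_{\delta,s})$ and $\beta=\Phi(\delta-z_{1-\alpha})$. Then $[\hat c^*,\infty)$ is a $1-\alpha$ CI, and $q_\beta(\hat c^*,\mathcal F)\le q_\beta(\hat c,\mathcal F)$ for every one-sided $1-\alpha$ CI $[\hat c,\infty)$. (ii) Suppose $\alpha\le\frac12$ and that $(\delta,s)$ minimizes $\mathrm{cv}_\alpha\big(\frac{\omega(\delta')}{2s'}-\frac{\delta'}2\big)s'$ (read as $\omega(\delta')/2$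 if $s'=0$) over all $\delta'>0$ and $s'\in\partial\omega(\delta')$. Then $\hat L_{\delta,s}\pm\mathrm{cv}_\alpha\big(\overline{\mathrm{bias}}(\hat L_{\delta,s})/\mathrm{sd}(\hat L_{\delta,s})\big)\,\mathrm{sd}(\hat L_{\delta,s})$ is a $1-\alpha$ CI, and it is the shortest among all FLCIs centered at affine estimators that are $1-\alpha$ CIs. (iii) Suppose that $(\delta,s)$ minimizes $\frac14(\omega(\delta')-\delta's')^2+s'^2$ over all $\delta'>0$ and $s'\in\partial\omega(\delta')$. Then $R(\hat L_{\delta,s})\le R(\hat L)$ for every affine estimator $\hat L$. -/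

import Mathlib

open MeasureTheory ProbabilityTheory
open scoped NNReal ENNReal

noncomputable section

/-- The `p`-th quantile `inf {t | P(T ≤ t) ≥ p}` of a law `μ` on the real line. -/
def lawQuantile (μ : Measure ℝ) (p : ℝ) : ℝ :=
  sInf {t : ℝ | p ≤ μ.real (Set.Iic t)}

/-- `z_p`, the `p`-th quantile of the standard normal law. -/
def zQuantile (p : ℝ) : ℝ := lawQuantile (gaussianReal 0 1) p

/-- `Φ`, the standard normal cdf. -/
def stdNormalCDF (t : ℝ) : ℝ := cdf (gaussianReal 0 1) t

/-- `cv_α(b)`, the `1 - α` quantile of `|N(b, 1)|`. -/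
def cv (α b : ℝ) : ℝ := lawQuantile ((gaussianReal b 1).map (fun t => |t|)) (1 - α)

/-- `cv_α(b / s) * s`, the half-length of the fixed-length CI around a normal estimator with
worst-case bias `b` and standard deviation `s`. For `s = 0` the estimator is deterministic and the
expression stands for its limit `|b|` as `s` tends to `0`. -/
def flciHalfLength (α b s : ℝ) : ℝ := if s = 0 then |b| else cv α (b / s) * s

/-- Fixed-design regression model with normal errors of known variance:
`n` units with covariates `x i`, treatment indicators `d i`, (known) weights `w i` that sum to one
and define the weighted average treatment effect, and the known variance function `var`. -/
structure TEModel (X : Type*) (n : ℕ) where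
  x : Fin n → X
  d : Fin n → Bool
  w : Fin n → ℝ
  sum_w : ∑ i, w i = 1
  var : X × Bool → ℝ≥0
  var_pos : ∀ i, 0 < var (x i, d i)

namespace TEModel

variable {X : Type*} {n : ℕ} (M : TEModel X n)

/-- The parameter `L f = ∑ i, w i * (f (x i, 1) - f (x i, 0))`. -/
def L (f : X × Bool → ℝ) : ℝ := ∑ i, M.w i * (f (M.x i, true) - f (M.x i, false))

/-- `P_f`, the law of the outcome vector `y`, where the `y i ~ N(f (x i, d i), σ² (x i, d i))`
are independent. -/
def law (f : X × Bool → ℝ) : Measure (Fin n → ℝ) :=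
  Measure.pi fun i => gaussianReal (f (M.x i, M.d i)) (M.var (M.x i, M.d i))

/-- The affine estimator `a + ∑ i, k i * y i`. -/
def affineEst (k : Fin n → ℝ) (a : ℝ) (y : Fin n → ℝ) : ℝ := a + ∑ i, k i * y i

/-- `E_f (T - L f)`. -/
def bias (T : (Fin n → ℝ) → ℝ) (f : X × Bool → ℝ) : ℝ := ∫ y, (T y - M.L f) ∂(M.law f)

/-- `sup_{f ∈ F} E_f (T - L f)`. -/
def maxBias (F : Set (X × Bool → ℝ)) (T : (Fin n → ℝ) → ℝ) : EReal :=
  ⨆ f ∈ F, (M.bias T f : EReal)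

/-- The standard deviation of the affine estimator with weights `k`. -/
def sd (k : Fin n → ℝ) : ℝ := √(∑ i, k i ^ 2 * (M.var (M.x i, M.d i) : ℝ))

/-- The worst-case root mean squared error `(sup_{f ∈ F} E_f (T - L f)²)^{1/2}`. -/
def worstRMSE (F : Set (X × Bool → ℝ)) (T : (Fin n → ℝ) → ℝ) : ℝ≥0∞ :=
  (⨆ f ∈ F, ∫⁻ y, ENNReal.ofReal ((T y - M.L f) ^ 2) ∂(M.law f)) ^ (1 / 2 : ℝ)

/-- `[c, ∞)` is a `1 - α` confidence interval for `L f` over `F`. -/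
def IsLowerCI (F : Set (X × Bool → ℝ)) (α : ℝ) (c : (Fin n → ℝ) → ℝ) : Prop :=
  Measurable c ∧ ∀ f ∈ F, 1 - α ≤ (M.law f).real {y | c y ≤ M.L f}

/-- `[T - χ, T + χ]` is a `1 - α` confidence interval for `L f` over `F`. -/
def IsFLCI (F : Set (X × Bool → ℝ)) (α : ℝ) (T : (Fin n → ℝ) → ℝ) (χ : ℝ) : Prop :=
  Measurable T ∧ ∀ f ∈ F, 1 - α ≤ (M.law f).real {y | M.L f ∈ Set.Icc (T y - χ) (T y + χ)}

/-- `q_β(c, G)`, the worst case over `g ∈ G` of the `β`-th quantile, under `g`, of the excess length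
`L g - c` of the one-sided CI `[c, ∞)`. -/
def excessQuantile (β : ℝ) (c : (Fin n → ℝ) → ℝ) (G : Set (X × Bool → ℝ)) : EReal :=
  ⨆ g ∈ G, (lawQuantile ((M.law g).map (fun y => M.L g - c y)) β : EReal)

/-- `∑ i, (f (x i, d i) - g (x i, d i))² / σ² (x i, d i)`. -/
def sqDist (f g : X × Bool → ℝ) : ℝ :=
  ∑ i, (f (M.x i, M.d i) - g (M.x i, M.d i)) ^ 2 / (M.var (M.x i, M.d i) : ℝ)

/-- The modulus of continuity `ω(δ)` of `L` over `F`. -/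
def modulus (F : Set (X × Bool → ℝ)) (δ : ℝ) : ℝ :=
  sSup {r : ℝ | ∃ f ∈ F, ∃ g ∈ F, M.sqDist f g ≤ δ ^ 2 ∧ r = M.L g - M.L f}

/-- The pair `f, g` attains the supremum that defines the modulus at `δ`
(which, in particular, is finite). -/
def AttainsModulus (F : Set (X × Bool → ℝ)) (δ : ℝ) (f g : X × Bool → ℝ) : Prop :=
  f ∈ F ∧ g ∈ F ∧ M.sqDist f g ≤ δ ^ 2 ∧
    ∀ f' ∈ F, ∀ g' ∈ F, M.sqDist f' g' ≤ δ ^ 2 → M.L g' - M.L f' ≤ M.L g - M.L f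

/-- The superdifferential at `δ` of the (concave) modulus, a function on `[0, ∞)`. -/
def superdiff (F : Set (X × Bool → ℝ)) (δ : ℝ) : Set ℝ :=
  {s : ℝ | ∀ δ' : ℝ, 0 ≤ δ' → M.modulus F δ' ≤ M.modulus F δ + s * (δ' - δ)}

/-- The weights `k*_δ` built from an extremal pair `f, g` and from `s = ω'(δ)`. -/
def optWeights (δ s : ℝ) (f g : X × Bool → ℝ) (i : Fin n) : ℝ :=
  s / δ * ((g (M.x i, M.d i) - f (M.x i, M.d i)) / (M.var (M.x i, M.d i) : ℝ))

/-- The centering constant `a*_δ`. -/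
def optCenter (δ s : ℝ) (f g : X × Bool → ℝ) : ℝ :=
  1 / 2 * (M.L (f + g) -
    ∑ i, M.optWeights δ s f g i * (f (M.x i, M.d i) + g (M.x i, M.d i)))

/-- The estimator `L̂_δ`. -/
def optEst (δ s : ℝ) (f g : X × Bool → ℝ) : (Fin n → ℝ) → ℝ :=
  affineEst (M.optWeights δ s f g) (M.optCenter δ s f g)

/-- `cv_α(ω(δ) / (2 s) - δ / 2) * s` with `s = ω'(δ)`; for `s = 0` it stands for its limit
`ω(δ) / 2` as `s` tends to `0`. -/
def flciCriterion (F : Set (X × Bool → ℝ)) (α δ s : ℝ) : ℝ :=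
  if s = 0 then M.modulus F δ / 2 else cv α (M.modulus F δ / (2 * s) - δ / 2) * s

/-- `(ω(δ) - δ s)² / 4 + s²` with `s = ω'(δ)`. -/
def rmseCriterion (F : Set (X × Bool → ℝ)) (δ s : ℝ) : ℝ :=
  1 / 4 * (M.modulus F δ - δ * s) ^ 2 + s ^ 2

end TEModel

end

/-! The error of an affine estimator at `f` is normal with mean `affineBias` and standard deviation
`sd`, so (ii) and (iii) only concern which pairs (worst bias, standard deviation) are attainable.
These pairs correspond to lines above the concave function ω. If the absolute bias is at most b on
the class and the standard deviation is τ, Cauchy–Schwarz gives ω(y) ≤ 2b + τy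
(`modulus_le_of_affineBias_le`). Conversely, the tangent line to ω at δ with slope s is realised by
the estimator built from an extremal pair: its standard deviation is s and its worst absolute bias
is half the intercept, (ω(δ) - δs)/2, by the first-order conditions for the pair
(`AttainsModulus.affineBias_abs_le`).

A line above ω can be replaced, up to arbitrarily small slack, by a tangent at a positive point
whose slope and intercept are no larger (`ConcaveOn.exists_supergradient_le`). Half-length (for α ≤
1/2) and mean squared error increase with bias and standard deviation, so minimising over tangents
minimises over all affine estimators.

In (i), normality bounds the quantile for the proposed interval by ω(δ)
(`AttainsModulus.excessQuantile_le`). No interval of the required level does better: a smaller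
quantile at g* would yield a test of a point of the segment from f* to g* against g* that is more
powerful than Neyman–Pearson permits (`AttainsModulus.le_excessQuantile`). -/

/-! ### Quantiles and the standard normal distribution function. -/

open Filter Topology in
/-- Galois connection between the quantile and the distribution function of a law. -/
theorem lawQuantile_le_iff (μ : Measure ℝ) [IsProbabilityMeasure μ] {p t : ℝ}
    (hp0 : 0 < p) (hp1 : p < 1) : lawQuantile μ p ≤ t ↔ p ≤ μ.real (Set.Iic t) := by
  have hne : {t : ℝ | p ≤ μ.real (Set.Iic t)}.Nonempty := by
    obtain ⟨t, ht⟩ := ((tendsto_cdf_atTop μ).eventually (eventually_ge_nhds hp1)).exists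
    exact ⟨t, by simpa [cdf_eq_real] using ht⟩
  have hbdd : BddBelow {t : ℝ | p ≤ μ.real (Set.Iic t)} := by
    obtain ⟨t, ht⟩ := ((tendsto_cdf_atBot μ).eventually (eventually_lt_nhds hp0)).exists
    refine ⟨t, fun u hu => ?_⟩
    by_contra! h
    have := monotone_cdf μ h.le
    rw [cdf_eq_real μ u] at this
    exact absurd (hu.trans this) (not_le.2 ht)
  constructor
  · intro h
    rw [← cdf_eq_real]
    have hc : Tendsto (cdf μ) (𝓝[>] t) (𝓝 (cdf μ t)) :=
      ((cdf μ).right_continuous t).mono_left (nhdsWithin_mono _ Set.Ioi_subset_Ici_self)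
    refine ge_of_tendsto hc ?_
    filter_upwards [self_mem_nhdsWithin] with u hu
    obtain ⟨v, hv, hvu⟩ := exists_lt_of_csInf_lt hne (lt_of_le_of_lt h hu)
    have := monotone_cdf μ hvu.le
    rw [cdf_eq_real μ v] at this
    exact le_trans hv this
  · intro h
    exact csInf_le hbdd h

theorem stdNormalCDF_eq (t : ℝ) : stdNormalCDF t = (gaussianReal 0 1).real (Set.Iic t) :=
  cdf_eq_real _ t

theorem gaussianReal_real_Ioo_pos {m : ℝ} {v : ℝ≥0} (hv : v ≠ 0) {a b : ℝ} (hab : a < b) :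
    0 < (gaussianReal m v).real (Set.Ioo a b) := by
  refine ENNReal.toReal_pos (fun h => ?_) (measure_ne_top _ _)
  have := gaussianReal_absolutelyContinuous' m hv h
  simp at this
  linarith

theorem stdNormalCDF_strictMono : StrictMono stdNormalCDF := by
  intro a b hab
  have h := gaussianReal_real_Ioo_pos (m := 0) (v := 1) one_ne_zero hab
  rw [stdNormalCDF_eq, stdNormalCDF_eq]
  have h2 : (gaussianReal 0 1).real (Set.Iic a ∪ Set.Ioo a b)
      ≤ (gaussianReal 0 1).real (Set.Iic b) :=
    measureReal_mono (by
      rintro x (hx | hx)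
      · exact le_trans hx hab.le
      · exact hx.2.le)
  rw [measureReal_union (by
    rw [Set.disjoint_left]; intro x hx hx'; exact absurd hx'.1 (not_lt.2 hx)) measurableSet_Ioo] at h2
  linarith

open Filter Topology in
theorem stdNormalCDF_zQuantile {p : ℝ} (hp0 : 0 < p) (hp1 : p < 1) :
    stdNormalCDF (zQuantile p) = p := by
  apply le_antisymm
  · have h0 : (cdf (gaussianReal 0 1)).measure {zQuantile p} = 0 := by
      rw [measure_cdf]
      have := nullSingletonClass_gaussianReal (μ := 0) (v := 1) one_ne_zero
      exact measure_singleton _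
    rw [StieltjesFunction.measure_singleton, ENNReal.ofReal_eq_zero, sub_nonpos] at h0
    refine h0.trans ?_
    refine le_of_tendsto ((monotone_cdf _).tendsto_leftLim _) ?_
    filter_upwards [self_mem_nhdsWithin] with u hu
    have := (lawQuantile_le_iff (gaussianReal 0 1) (t := u) hp0 hp1).not.1 (not_le.2 hu)
    rw [cdf_eq_real]
    exact (not_le.1 this).le
  · rw [stdNormalCDF_eq]
    exact (lawQuantile_le_iff _ hp0 hp1).1 le_rfl

theorem stdNormalCDF_pos (t : ℝ) : 0 < stdNormalCDF t :=
  lt_of_le_of_lt (cdf_nonneg _ (t - 1)) (stdNormalCDF_strictMono (by linarith))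

theorem stdNormalCDF_lt_one (t : ℝ) : stdNormalCDF t < 1 :=
  lt_of_lt_of_le (stdNormalCDF_strictMono (by linarith)) (cdf_le_one _ (t + 1))

theorem stdNormalCDF_neg (t : ℝ) : stdNormalCDF (-t) = 1 - stdNormalCDF t := by
  have h1 : (gaussianReal 0 1).real (Set.Iic (-t)) = (gaussianReal 0 1).real (Set.Ici t) := by
    have := gaussianReal_map_neg (μ := 0) (v := 1)
    rw [neg_zero] at this
    conv_lhs => rw [← this]
    rw [map_measureReal_apply (by fun_prop) measurableSet_Iic]
    congr 1; ext x; simp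
  have h2 := nullSingletonClass_gaussianReal (μ := 0) (v := 1) one_ne_zero
  rw [stdNormalCDF_eq, stdNormalCDF_eq, h1, ← probReal_compl_eq_one_sub measurableSet_Iic,
    Set.compl_Iic]
  exact (measureReal_congr Ioi_ae_eq_Ici).symm

/-- Writing the level as Φ(x) keeps it strictly between 0 and 1, so the degenerate case `s = 0` is
included: every such quantile of a point mass is its location. -/
theorem lawQuantile_affine (m : ℝ) {s : ℝ} (hs : 0 ≤ s) (x : ℝ) :
    lawQuantile ((gaussianReal 0 1).map fun z => m + s * z) (stdNormalCDF x) = m + s * x := by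
  have := Measure.isProbabilityMeasure_map (μ := gaussianReal 0 1) (f := fun z : ℝ => m + s * z)
    (by fun_prop)
  refine eq_of_forall_ge_iff fun t => ?_
  rw [lawQuantile_le_iff _ (stdNormalCDF_pos x) (stdNormalCDF_lt_one x),
    map_measureReal_apply (by fun_prop) measurableSet_Iic]
  rcases hs.eq_or_lt with rfl | hs
  · by_cases h : m ≤ t
    · simp [h, (stdNormalCDF_lt_one x).le]
    · simp [h, stdNormalCDF_pos x]
  · have : (fun z : ℝ => m + s * z) ⁻¹' Set.Iic t = Set.Iic ((t - m) / s) := by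
      ext z; simp only [Set.mem_preimage, Set.mem_Iic]; rw [le_div_iff₀ hs]
      constructor <;> intro h <;> linarith
    rw [this, ← stdNormalCDF_eq, stdNormalCDF_strictMono.le_iff_le, le_div_iff₀ hs]
    constructor <;> intro h <;> linarith

/-! ### Coverage of symmetric intervals as bias and standard deviation vary. -/

/-- The interval of half-length `χ` around a normal estimator with bias `b` and standard deviation
`s` covers with probability at least `1 - α`. -/
def Covers (α b s χ : ℝ) : Prop := 1 - α ≤ (gaussianReal 0 1).real {z | |b + s * z| ≤ χ}

theorem flciHalfLength_le_iff {α : ℝ} (hα0 : 0 < α) (hα1 : α < 1) (b χ : ℝ) {s : ℝ} (hs : 0 ≤ s) :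
    flciHalfLength α b s ≤ χ ↔ Covers α b s χ := by
  unfold flciHalfLength Covers
  split_ifs with h
  · subst h
    by_cases hb : |b| ≤ χ
    · simp [hb, hα0.le]
    · simp [hb, hα1]
  · have hs : 0 < s := lt_of_le_of_ne hs (Ne.symm h)
    have hp := Measure.isProbabilityMeasure_map (μ := gaussianReal (b / s) 1)
      (f := fun t : ℝ => |t|) (by fun_prop)
    rw [← le_div_iff₀ hs, cv, lawQuantile_le_iff _ (by linarith) (by linarith),
      map_measureReal_apply (by fun_prop) measurableSet_Iic]
    have := gaussianReal_map_const_add (μ := 0) (v := 1) (b / s)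
    rw [zero_add] at this
    rw [← this, map_measureReal_apply (by fun_prop)
      ((by fun_prop : Measurable fun t : ℝ => |t|) measurableSet_Iic)]
    have : ((b / s + ·) ⁻¹' ((fun t : ℝ => |t|) ⁻¹' Set.Iic (χ / s)))
        = {z : ℝ | |b + s * z| ≤ χ} := by
      ext z
      simp only [Set.mem_preimage, Set.mem_Iic, Set.mem_ofPred_eq]
      rw [le_div_iff₀ hs]
      nth_rewrite 2 [← abs_of_pos hs]
      rw [← abs_mul, add_mul, div_mul_cancel₀ _ h, mul_comm z]
    rw [this]

theorem Covers.mono {α b s χ χ' : ℝ} (h : Covers α b s χ) (hχ : χ ≤ χ') : Covers α b s χ' :=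
  le_trans h (measureReal_mono fun _ hz => le_trans hz hχ)

theorem Covers.nonneg {α b s χ : ℝ} (hα1 : α < 1) (h : Covers α b s χ) : 0 ≤ χ := by
  by_contra! hχ
  have : {z : ℝ | |b + s * z| ≤ χ} = ∅ := by
    ext z; simpa using lt_of_lt_of_le hχ (abs_nonneg _)
  rw [Covers, this] at h
  simp at h; linarith

theorem Covers.neg {α b s χ : ℝ} (h : Covers α b s χ) : Covers α (-b) s χ := by
  have h1 := gaussianReal_map_neg (μ := 0) (v := 1)
  rw [neg_zero] at h1
  unfold Covers at h ⊢
  rw [← h1, map_measureReal_apply (by fun_prop)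
    (measurableSet_le (by fun_prop) (by fun_prop))]
  convert h using 3
  ext z
  simp only [Set.mem_preimage, Set.mem_ofPred_eq]
  rw [← abs_neg]; ring_nf

theorem Covers.abs {α b s χ : ℝ} (h : Covers α b s χ) : Covers α |b| s χ := by
  rcases abs_choice b with hb | hb <;> rw [hb]
  exacts [h, h.neg]

theorem Covers.add {α b s χ ε : ℝ} (hε : 0 ≤ ε) (h : Covers α b s χ) :
    Covers α (b + ε) s (χ + ε) := by
  refine le_trans h (measureReal_mono fun z hz => ?_)
  simp only [Set.mem_ofPred_eq] at hz ⊢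
  rw [abs_le] at hz ⊢
  constructor <;> linarith [hz.1, hz.2]

theorem Covers.mul {α b s χ c : ℝ} (hc : 0 ≤ c) (h : Covers α b s χ) :
    Covers α (c * b) (c * s) (c * χ) := by
  refine le_trans h (measureReal_mono fun z hz => ?_)
  simp only [Set.mem_ofPred_eq] at hz ⊢
  rw [mul_assoc, ← mul_add, abs_mul, abs_of_nonneg hc]
  exact mul_le_mul_of_nonneg_left hz hc

theorem gaussianReal_real_Icc_eq (u v : ℝ) (huv : u ≤ v) :
    (gaussianReal 0 1).real (Set.Icc u v) = ∫ z in u..v, gaussianPDFReal 0 1 z := by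
  rw [measureReal_def, gaussianReal_apply_eq_integral _ one_ne_zero,
    ENNReal.toReal_ofReal (integral_nonneg fun _ => gaussianPDFReal_nonneg _ _ _),
    intervalIntegral.integral_of_le huv, integral_Icc_eq_integral_Ioc]

theorem gaussianPDFReal_le_of_abs_le {x y : ℝ} (h : |x| ≤ |y|) :
    gaussianPDFReal 0 1 y ≤ gaussianPDFReal 0 1 x := by
  unfold gaussianPDFReal
  have := sq_le_sq.2 h
  simp only [sub_zero]
  gcongr

/-- Symmetric intervals cover less as the bias grows. -/
theorem Covers.anti_bias {α b b' s χ : ℝ} (hα1 : α < 1) (hs : 0 ≤ s) (hb : |b| ≤ b')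
    (h : Covers α b' s χ) : Covers α b s χ := by
  wlog hb0 : 0 ≤ b generalizing b with H
  · have := (H (b := -b) (by simpa using hb) (by linarith)).neg
    simpa using this
  rw [abs_of_nonneg hb0] at hb
  have hχ := h.nonneg hα1
  rcases hs.eq_or_lt with rfl | hs
  · refine le_trans h (measureReal_mono fun z hz => ?_)
    simp only [Set.mem_ofPred_eq, zero_mul, add_zero] at hz ⊢
    rw [abs_of_nonneg hb0]; rw [abs_of_nonneg (by linarith)] at hz; linarith
  · refine le_trans h ?_
    have key : ∀ e : ℝ, {z : ℝ | |e + s * z| ≤ χ} = Set.Icc ((-χ - e) / s) ((χ - e) / s) := by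
      intro e; ext z
      simp only [Set.mem_ofPred_eq, Set.mem_Icc, abs_le, div_le_iff₀ hs, le_div_iff₀ hs]
      constructor <;> rintro ⟨h1, h2⟩ <;> constructor <;> linarith
    have hle : ∀ e : ℝ, (-χ - e) / s ≤ (χ - e) / s := fun e => by
      gcongr; linarith
    rw [key, key, gaussianReal_real_Icc_eq _ _ (hle _), gaussianReal_real_Icc_eq _ _ (hle _)]
    have hi : ∀ u v : ℝ, IntervalIntegrable (gaussianPDFReal 0 1) volume u v := fun u v =>
      (integrable_gaussianPDFReal 0 1).intervalIntegrable
    have e1 := intervalIntegral.integral_add_adjacent_intervals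
      (hi ((-χ - b') / s) ((-χ - b) / s)) (hi ((-χ - b) / s) ((χ - b) / s))
    have e2 := intervalIntegral.integral_add_adjacent_intervals
      (hi ((-χ - b') / s) ((χ - b') / s)) (hi ((χ - b') / s) ((χ - b) / s))
    have hlow : (-χ - b') / s ≤ (-χ - b) / s := by gcongr
    -- Lowering the bias shifts the interval to the right: it loses a strip on the left and gains
    -- the translate of that strip by 2χ/s. On the lost strip z ≤ -χ/s, hence |z + 2χ/s| ≤ |z| and
    -- the density is at least as large after translation.
    have e3 : ∫ z in ((-χ - b') / s)..((-χ - b) / s), gaussianPDFReal 0 1 z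
        ≤ ∫ z in ((χ - b') / s)..((χ - b) / s), gaussianPDFReal 0 1 z := by
      have hs1 : (χ - b') / s = (-χ - b') / s + 2 * χ / s := by field_simp; ring
      have hs2 : (χ - b) / s = (-χ - b) / s + 2 * χ / s := by field_simp; ring
      rw [hs1, hs2, ← intervalIntegral.integral_comp_add_right]
      refine intervalIntegral.integral_mono_on hlow (hi _ _)
        ((integrable_gaussianPDFReal 0 1).comp_add_right _).intervalIntegrable ?_
      intro z hz
      apply gaussianPDFReal_le_of_abs_le
      have hz2 : z ≤ - (χ / s) := by
        refine hz.2.trans ?_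
        rw [← neg_div]; gcongr; linarith
      have h3 : 0 ≤ χ / s := by positivity
      have h4 : 2 * χ / s = 2 * (χ / s) := by ring
      rw [abs_of_nonpos (by linarith : z ≤ 0), abs_le, h4]
      constructor <;> linarith
    linarith

/-- If |b| > χ, covering forces the noise to one side of a nonzero threshold, an event of
probability below 1/2. This is where α ≤ 1/2 enters. -/
theorem Covers.abs_le {α b s χ : ℝ} (hα : α ≤ 1 / 2) (hs : 0 ≤ s) (h : Covers α b s χ) :
    |b| ≤ χ := by
  replace h := h.abs
  by_contra! hb
  have h0 : stdNormalCDF 0 = 1 / 2 := by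
    have := stdNormalCDF_neg 0
    rw [neg_zero] at this; linarith
  rcases hs.eq_or_lt with rfl | hs
  · unfold Covers at h
    simp [not_le.2 hb] at h; linarith
  · have h1 : (gaussianReal 0 1).real {z | |(|b|) + s * z| ≤ χ} ≤ stdNormalCDF ((χ - |b|) / s) := by
      rw [stdNormalCDF_eq]
      refine measureReal_mono fun z hz => ?_
      simp only [Set.mem_ofPred_eq, Set.mem_Iic] at hz ⊢
      rw [le_div_iff₀ hs]
      linarith [(_root_.abs_le.1 hz).2]
    have h2 : stdNormalCDF ((χ - |b|) / s) < stdNormalCDF 0 :=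
      stdNormalCDF_strictMono (div_neg_of_neg_of_pos (by linarith) hs)
    unfold Covers at h
    linarith

/-- At confidence levels of at least one half, symmetric intervals cover more as the standard
deviation falls. -/
theorem Covers.anti_sd {α b s s' χ : ℝ} (hα : α ≤ 1 / 2) (hs : 0 ≤ s) (hss : s ≤ s')
    (h : Covers α b s' χ) : Covers α b s χ := by
  have hb := h.abs_le hα (hs.trans hss)
  refine le_trans h (measureReal_mono fun z hz => ?_)
  simp only [Set.mem_ofPred_eq] at hz ⊢
  rw [_root_.abs_le] at hz hb ⊢
  rcases le_total 0 z with h0 | h0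
  · have := mul_le_mul_of_nonneg_right hss h0
    have := mul_nonneg hs h0
    constructor <;> linarith
  · have := mul_le_mul_of_nonpos_right hss h0
    have := mul_nonpos_of_nonneg_of_nonpos hs h0
    constructor <;> linarith

/-- Provides the strict room in the standard deviation that the tangent-line lemma requires. -/
theorem exists_covers_gt {α b s χ η : ℝ} (hα0 : 0 < α) (hα1 : α < 1) (hs : 0 ≤ s) (hη : 0 < η)
    (h : Covers α b s χ) : ∃ s' > s, Covers α b s' (χ + η) := by
  have hχ := h.nonneg hα1
  rcases hs.eq_or_lt with rfl | hs
  · have hb : |b| ≤ χ := by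
      have := (flciHalfLength_le_iff hα0 hα1 b χ le_rfl).2 h
      simpa [flciHalfLength] using this
    -- With no noise initially, noise of scale η/K stays within η with probability at least 1 - α.
    have hK : Covers α 0 1 (|flciHalfLength α 0 1| + 1) :=
      (flciHalfLength_le_iff hα0 hα1 0 _ zero_le_one).1
        (by linarith [le_abs_self (flciHalfLength α 0 1)])
    set K := |flciHalfLength α 0 1| + 1
    have hK0 : 0 < K := by positivity
    refine ⟨η / K, by positivity, le_trans hK (measureReal_mono fun z hz => ?_)⟩
    simp only [Set.mem_ofPred_eq, zero_add, one_mul] at hz ⊢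
    calc |b + η / K * z| ≤ |b| + |η / K * z| := abs_add_le _ _
      _ = |b| + η / K * |z| := by rw [abs_mul, abs_of_pos (by positivity : 0 < η / K)]
      _ ≤ χ + η / K * K := by gcongr
      _ = χ + η := by field_simp
  -- Scale bias, deviation and length by c > 1, then lower the bias back to b. The choice of c gives
  -- cχ ≤ χ + η, and the added 1 handles χ = 0.
  · set c := 1 + η / (χ + 1)
    have hc : 1 < c := by simp only [c]; linarith [div_pos hη (by linarith : 0 < χ + 1)]
    refine ⟨c * s, by nlinarith, ?_⟩
    have h1 : Covers α (c * b) (c * s) (c * χ) := h.mul (by linarith)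
    have h2 : Covers α |c * b| (c * s) (c * χ) := h1.abs
    refine (h2.anti_bias hα1 (by positivity) ?_).mono ?_
    · rw [abs_mul, abs_of_pos (by linarith : 0 < c)]
      nlinarith [abs_nonneg b]
    · have : η / (χ + 1) * χ ≤ η := by
        rw [div_mul_eq_mul_div, div_le_iff₀ (by linarith)]; nlinarith
      simp only [c]; linarith

/-! ### Likelihood ratios and product normal laws. -/

/-- **Neyman-Pearson lemma**: among all events that are at most as likely under `μ`, an upper level
set of the likelihood ratio is the most likely one under `μ.withDensity D`. -/
theorem withDensity_apply_le_of_levelSet {Ω : Type*} [MeasurableSpace Ω] (μ : Measure Ω)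
    [IsFiniteMeasure μ] {D : Ω → ℝ≥0∞} {C : ℝ≥0∞}
    {A R : Set Ω} (hA : MeasurableSet A) (hR : MeasurableSet R)
    (hDR : ∀ y ∈ R, C ≤ D y) (hDR' : ∀ y ∉ R, D y ≤ C) (h : μ A ≤ μ R) :
    μ.withDensity D A ≤ μ.withDensity D R := by
  have h1 : μ (A \ R) ≤ μ (R \ A) := by
    rw [← measure_inter_add_sdiff A hR, ← measure_inter_add_sdiff R hA, Set.inter_comm R A] at h
    exact (ENNReal.add_le_add_iff_left (measure_ne_top _ _)).1 h
  have h2 : μ.withDensity D (A \ R) ≤ C * μ (A \ R) := by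
    rw [withDensity_apply _ (hA.diff hR), ← setLIntegral_const]
    exact setLIntegral_mono' (hA.diff hR) fun y hy => hDR' y hy.2
  have h3 : C * μ (R \ A) ≤ μ.withDensity D (R \ A) := by
    rw [withDensity_apply _ (hR.diff hA), ← setLIntegral_const]
    exact setLIntegral_mono' (hR.diff hA) fun y hy => hDR y hy.1
  rw [← measure_inter_add_sdiff A hR, ← measure_inter_add_sdiff R hA, Set.inter_comm R A]
  exact add_le_add le_rfl (h2.trans ((mul_le_mul_right h1 C).trans h3))

theorem gaussianReal_eq_withDensity (m m' : ℝ) {v : ℝ≥0} (hv : v ≠ 0) :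
    gaussianReal m' v = (gaussianReal m v).withDensity fun y =>
      ENNReal.ofReal (Real.exp ((m' - m) / v * (y - m) - (m' - m) ^ 2 / (2 * v))) := by
  rw [gaussianReal_of_var_ne_zero _ hv, gaussianReal_of_var_ne_zero _ hv,
    ← withDensity_mul _ (measurable_gaussianPDF m v) (by fun_prop)]
  congr 1
  ext y
  have hv' : (v : ℝ) ≠ 0 := by exact_mod_cast hv
  rw [Pi.mul_apply, gaussianPDF, gaussianPDF, ← ENNReal.ofReal_mul (gaussianPDFReal_nonneg _ _ _)]
  congr 1
  unfold gaussianPDFReal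
  conv_rhs => rw [mul_assoc, ← Real.exp_add]
  congr 2
  field_simp
  ring

/-- On a box the indicator factors over the coordinates, and coordinates are independent under the
product measure, so the integral factors too. -/
theorem pi_withDensity {ι : Type*} [Fintype ι] {Ω : ι → Type*} [∀ i, MeasurableSpace (Ω i)]
    (μ : ∀ i, Measure (Ω i)) [∀ i, IsProbabilityMeasure (μ i)] {r : ∀ i, Ω i → ℝ≥0∞}
    (hr : ∀ i, Measurable (r i)) [∀ i, SigmaFinite ((μ i).withDensity (r i))] :
    Measure.pi (fun i => (μ i).withDensity (r i))
      = (Measure.pi μ).withDensity fun y => ∏ i, r i (y i) := by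
  refine Measure.pi_eq fun s hs => ?_
  rw [withDensity_apply _ (MeasurableSet.univ_pi hs),
    ← lintegral_indicator (MeasurableSet.univ_pi hs)]
  have h1 : (Set.univ.pi s).indicator (fun y => ∏ i, r i (y i))
      = fun y => ∏ i, (s i).indicator (r i) (y i) := by
    ext y
    by_cases hy : y ∈ Set.univ.pi s
    · rw [Set.indicator_of_mem hy]
      exact Finset.prod_congr rfl fun i _ => (Set.indicator_of_mem (hy i trivial) _).symm
    · rw [Set.indicator_of_notMem hy]
      obtain ⟨i, hi⟩ : ∃ i, y i ∉ s i := by simpa [Set.mem_univ_pi] using hy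
      exact (Finset.prod_eq_zero (Finset.mem_univ i) (Set.indicator_of_notMem hi _)).symm
  have hm : ∀ i, Measurable ((s i).indicator (r i)) := fun i => (hr i).indicator (hs i)
  rw [h1, lintegral_prod_eq_prod_lintegral_of_indepFun Finset.univ
    (fun i (y : ∀ i, Ω i) => (s i).indicator (r i) (y i))
    (iIndepFun_pi fun i => (hm i).aemeasurable) fun i => (hm i).comp (measurable_pi_apply i)]
  refine Finset.prod_congr rfl fun i _ => ?_
  rw [withDensity_apply _ (hs i), ← lintegral_indicator (hs i)]
  exact (measurePreserving_eval μ i).lintegral_comp (hm i)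

theorem map_sum_mul_pi_gaussianReal {ι : Type*} [Fintype ι] (m : ι → ℝ) (v : ι → ℝ≥0)
    (k : ι → ℝ) (s : Finset ι) :
    (Measure.pi fun i => gaussianReal (m i) (v i)).map (∑ i ∈ s, fun y => k i * y i)
      = gaussianReal (∑ i ∈ s, k i * m i) (∑ i ∈ s, .mk (k i ^ 2) (sq_nonneg _) * v i) := by
  classical
  have hind : iIndepFun (fun i (y : ι → ℝ) => k i * y i)
      (Measure.pi fun i => gaussianReal (m i) (v i)) :=
    iIndepFun_pi (X := fun i (z : ℝ) => k i * z) fun i => by fun_prop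
  induction s using Finset.induction_on with
  | empty =>
    simp only [Finset.sum_empty, gaussianReal_zero_var]
    exact (Measure.map_const _ _).trans (by rw [measure_univ, one_smul]; rfl)
  | insert i s hi ih =>
    rw [Finset.sum_insert hi, Finset.sum_insert hi, Finset.sum_insert hi]
    refine gaussianReal_add_gaussianReal_of_indepFun
      (hind.indepFun_finsetSum_of_notMem (fun i => by fun_prop) hi).symm ?_ ih
    have h2 : (fun y : ι → ℝ => k i * y i) = (k i * ·) ∘ Function.eval i := rfl
    rw [h2, ← Measure.map_map (by fun_prop) (by fun_prop), (measurePreserving_eval _ i).map_eq,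
      gaussianReal_map_const_mul]

/-! ### Affine estimators in the normal model, and the power bound. -/

namespace TEModel

variable {X : Type*} {n : ℕ} (M : TEModel X n)

instance (f : X × Bool → ℝ) : IsProbabilityMeasure (M.law f) := by
  unfold law; infer_instance

theorem sd_nonneg (k : Fin n → ℝ) : 0 ≤ M.sd k := Real.sqrt_nonneg _

theorem sd_sq (k : Fin n → ℝ) : M.sd k ^ 2 = ∑ i, k i ^ 2 * (M.var (M.x i, M.d i) : ℝ) :=
  Real.sq_sqrt (Finset.sum_nonneg fun _ _ => by positivity)

theorem measurable_affineEst (k : Fin n → ℝ) (a : ℝ) : Measurable (affineEst k a) := by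
  unfold affineEst; fun_prop

theorem map_affineEst_law (f : X × Bool → ℝ) (k : Fin n → ℝ) (a : ℝ) :
    (M.law f).map (affineEst k a)
      = (gaussianReal 0 1).map fun z => (a + ∑ i, k i * f (M.x i, M.d i)) + M.sd k * z := by
  have h1 : affineEst k a = (a + ·) ∘ (∑ i, fun y : Fin n → ℝ => k i * y i) := by
    ext y; simp [affineEst]
  have h2 : (fun z => (a + ∑ i, k i * f (M.x i, M.d i)) + M.sd k * z)
      = ((a + ∑ i, k i * f (M.x i, M.d i)) + ·) ∘ (M.sd k * ·) := rfl
  rw [h1, ← Measure.map_map (by fun_prop) (by fun_prop), law, map_sum_mul_pi_gaussianReal,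
    gaussianReal_map_const_add, h2, ← Measure.map_map (by fun_prop) (by fun_prop),
    gaussianReal_map_const_mul, gaussianReal_map_const_add]
  congr 1
  · ring
  · ext
    push_cast
    simp [M.sd_sq]

/-- The bias at `f` of the affine estimator with weights `k` and centering constant `a`. -/
def affineBias (k : Fin n → ℝ) (a : ℝ) (f : X × Bool → ℝ) : ℝ :=
  a + ∑ i, k i * f (M.x i, M.d i) - M.L f

theorem map_affineEst_sub_law (f : X × Bool → ℝ) (k : Fin n → ℝ) (a : ℝ) :
    (M.law f).map (fun y => affineEst k a y - M.L f)
      = (gaussianReal 0 1).map fun z => M.affineBias k a f + M.sd k * z := by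
  have h := M.map_affineEst_law f k (a - M.L f)
  convert h using 2
  · ext y; simp only [affineEst]; ring
  · ext z; simp only [affineBias]; ring

theorem law_real_preimage (f : X × Bool → ℝ) (k : Fin n → ℝ) (a : ℝ) {S : Set ℝ}
    (hS : MeasurableSet S) : (M.law f).real {y | affineEst k a y - M.L f ∈ S}
      = (gaussianReal 0 1).real {z | M.affineBias k a f + M.sd k * z ∈ S} := by
  have h := congrArg (fun μ => μ.real S) (M.map_affineEst_sub_law f k a)
  rwa [map_measureReal_apply ((measurable_affineEst k a).sub_const _) hS,
    map_measureReal_apply (by fun_prop) hS] at h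

theorem _root_.integral_affine_gaussianReal (b s : ℝ) :
    ∫ z, b + s * z ∂(gaussianReal 0 1) = b := by
  have hi : Integrable (fun z : ℝ => z) (gaussianReal 0 1) :=
    (memLp_id_gaussianReal 1).integrable le_rfl
  rw [integral_add (integrable_const b) (hi.const_mul s), integral_const_mul,
    integral_id_gaussianReal]
  simp

theorem bias_affineEst (f : X × Bool → ℝ) (k : Fin n → ℝ) (a : ℝ) :
    M.bias (affineEst k a) f = M.affineBias k a f := by
  have h := integral_map (μ := M.law f) (φ := fun y => affineEst k a y - M.L f)
    ((measurable_affineEst k a).sub_const _).aemeasurable (f := fun t : ℝ => t) (by fun_prop)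
  rw [bias, ← h, map_affineEst_sub_law, integral_map (by fun_prop) (by fun_prop),
    integral_affine_gaussianReal]

theorem lintegral_sq_affineEst (f : X × Bool → ℝ) (k : Fin n → ℝ) (a : ℝ) :
    ∫⁻ y, ENNReal.ofReal ((affineEst k a y - M.L f) ^ 2) ∂(M.law f)
      = ENNReal.ofReal (M.affineBias k a f ^ 2 + M.sd k ^ 2) := by
  have h := lintegral_map (μ := M.law f) (g := fun y => affineEst k a y - M.L f)
    (f := fun t => ENNReal.ofReal (t ^ 2)) (by fun_prop) ((measurable_affineEst k a).sub_const _)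
  rw [← h, map_affineEst_sub_law, lintegral_map (by fun_prop) (by fun_prop)]
  have hid : MemLp (fun z : ℝ => z) 2 (gaussianReal 0 1) := memLp_id_gaussianReal' 2 (by simp)
  have h2 : MemLp (fun z : ℝ => M.affineBias k a f + M.sd k * z) 2 (gaussianReal 0 1) := by
    generalize M.affineBias k a f = b
    generalize M.sd k = s
    have h3 : MemLp (fun z : ℝ => s * z) 2 (gaussianReal 0 1) := hid.const_mul s
    have h4 : MemLp (fun _ : ℝ => b) 2 (gaussianReal 0 1) := memLp_const b
    exact h4.add h3
  rw [← ofReal_integral_eq_lintegral_ofReal h2.integrable_sq (.of_forall fun _ => sq_nonneg _)]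
  congr 1
  have h3 := variance_eq_sub h2
  have h4 : Var[fun z : ℝ => M.affineBias k a f + M.sd k * z; gaussianReal 0 1] = M.sd k ^ 2 := by
    rw [variance_const_add (by fun_prop), variance_const_mul, variance_fun_id_gaussianReal]; simp
  rw [h4, integral_affine_gaussianReal] at h3
  simp only [Pi.pow_apply] at h3
  linarith

theorem isFLCI_affineEst_iff (F : Set (X × Bool → ℝ)) (α χ : ℝ) (k : Fin n → ℝ) (a : ℝ) :
    M.IsFLCI F α (affineEst k a) χ
      ↔ ∀ f ∈ F, Covers α (M.affineBias k a f) (M.sd k) χ := by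
  have hS : MeasurableSet {t : ℝ | |t| ≤ χ} := measurableSet_le (by fun_prop) (by fun_prop)
  unfold IsFLCI Covers
  refine ⟨fun h f hf => ?_, fun h => ⟨measurable_affineEst k a, fun f hf => ?_⟩⟩
  · have h1 := M.law_real_preimage f k a hS
    refine (h.2 f hf).trans (le_of_eq (Eq.trans ?_ h1))
    congr 1; ext y
    simp only [Set.mem_ofPred_eq, Set.mem_Icc, abs_le]
    constructor <;> rintro ⟨h1, h2⟩ <;> constructor <;> linarith
  · have h1 := M.law_real_preimage f k a hS
    refine (h f hf).trans (le_of_eq (Eq.trans h1.symm ?_))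
    congr 1; ext y
    simp only [Set.mem_ofPred_eq, Set.mem_Icc, abs_le]
    constructor <;> rintro ⟨h1, h2⟩ <;> constructor <;> linarith

/-- The log-likelihood ratio is affine in `y`, so its upper level sets are events about an affine
estimator, whose law is normal. -/
theorem law_eq_withDensity (f g : X × Bool → ℝ) :
    M.law g = (M.law f).withDensity fun y => ENNReal.ofReal (Real.exp
      (affineEst (fun i => (g (M.x i, M.d i) - f (M.x i, M.d i)) / (M.var (M.x i, M.d i) : ℝ))
        (-∑ i, (g (M.x i, M.d i) - f (M.x i, M.d i)) / (M.var (M.x i, M.d i) : ℝ)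
          * f (M.x i, M.d i)) y - M.sqDist f g / 2)) := by
  have hv : ∀ i, M.var (M.x i, M.d i) ≠ 0 := fun i => (M.var_pos i).ne'
  have h1 := fun i => gaussianReal_eq_withDensity (f (M.x i, M.d i)) (g (M.x i, M.d i)) (hv i)
  have hs : ∀ i, SigmaFinite ((gaussianReal (f (M.x i, M.d i)) (M.var (M.x i, M.d i))).withDensity
      fun y => ENNReal.ofReal (Real.exp ((g (M.x i, M.d i) - f (M.x i, M.d i)) /
        (M.var (M.x i, M.d i) : ℝ) * (y - f (M.x i, M.d i)) -
        (g (M.x i, M.d i) - f (M.x i, M.d i)) ^ 2 / (2 * (M.var (M.x i, M.d i) : ℝ))))) :=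
    fun i => by rw [← h1 i]; infer_instance
  have h2 := pi_withDensity (fun i => gaussianReal (f (M.x i, M.d i)) (M.var (M.x i, M.d i)))
    (r := fun i y => ENNReal.ofReal (Real.exp ((g (M.x i, M.d i) - f (M.x i, M.d i)) /
        (M.var (M.x i, M.d i) : ℝ) * (y - f (M.x i, M.d i)) -
        (g (M.x i, M.d i) - f (M.x i, M.d i)) ^ 2 / (2 * (M.var (M.x i, M.d i) : ℝ)))))
    (fun i => by fun_prop)
  have h3 : M.law g = Measure.pi fun i => (gaussianReal (f (M.x i, M.d i))
      (M.var (M.x i, M.d i))).withDensity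
      fun y => ENNReal.ofReal (Real.exp ((g (M.x i, M.d i) - f (M.x i, M.d i)) /
        (M.var (M.x i, M.d i) : ℝ) * (y - f (M.x i, M.d i)) -
        (g (M.x i, M.d i) - f (M.x i, M.d i)) ^ 2 / (2 * (M.var (M.x i, M.d i) : ℝ)))) := by
    unfold law
    congr 1
    ext1 i
    exact h1 i
  rw [h3, h2]
  unfold law
  congr 1
  ext y
  rw [← ENNReal.ofReal_prod_of_nonneg fun _ _ => (Real.exp_pos _).le, ← Real.exp_sum]
  congr 2
  simp only [affineEst, sqDist]
  rw [Finset.sum_div, ← Finset.sum_neg_distrib, ← Finset.sum_add_distrib,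
    ← Finset.sum_sub_distrib]
  refine Finset.sum_congr rfl fun i _ => ?_
  have : (M.var (M.x i, M.d i) : ℝ) ≠ 0 := by exact_mod_cast hv i
  field_simp
  ring

/-- The power of a level `α` test of `f` against `g`. -/
theorem law_real_le_stdNormalCDF {f g : X × Bool → ℝ} {δ z : ℝ} (hδ : 0 < δ)
    (hfg : M.sqDist f g = δ ^ 2) {A : Set (Fin n → ℝ)} (hA : MeasurableSet A)
    (h : (M.law f).real A ≤ 1 - stdNormalCDF z) :
    (M.law g).real A ≤ stdNormalCDF (δ - z) := by
  set k : Fin n → ℝ :=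
    fun i => (g (M.x i, M.d i) - f (M.x i, M.d i)) / (M.var (M.x i, M.d i) : ℝ) with hk
  set a : ℝ := -∑ i, k i * f (M.x i, M.d i) with ha
  have hv : ∀ i, (M.var (M.x i, M.d i) : ℝ) ≠ 0 := fun i => by exact_mod_cast (M.var_pos i).ne'
  have hsd : M.sd k = δ := by
    rw [← sq_eq_sq₀ (M.sd_nonneg k) hδ.le, sd_sq, ← hfg, sqDist]
    refine Finset.sum_congr rfl fun i _ => ?_
    have := hv i
    simp only [hk]; field_simp; ring
  have hg : a + ∑ i, k i * g (M.x i, M.d i) = δ ^ 2 := by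
    rw [ha, ← hfg, sqDist, ← Finset.sum_neg_distrib, ← Finset.sum_add_distrib]
    refine Finset.sum_congr rfl fun i _ => ?_
    have := hv i
    simp only [hk]; field_simp; ring
  have hf : a + ∑ i, k i * f (M.x i, M.d i) = 0 := by rw [ha]; ring
  have hR : MeasurableSet (affineEst k a ⁻¹' Set.Ioi (δ * z)) :=
    measurable_affineEst k a measurableSet_Ioi
  have hPf : (M.law f).real (affineEst k a ⁻¹' Set.Ioi (δ * z)) = 1 - stdNormalCDF z := by
    rw [← map_measureReal_apply (measurable_affineEst k a) measurableSet_Ioi, map_affineEst_law,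
      hf, hsd, map_measureReal_apply (by fun_prop) measurableSet_Ioi, stdNormalCDF_eq,
      ← probReal_compl_eq_one_sub measurableSet_Iic]
    congr 1; ext t
    simp [mul_lt_mul_iff_right₀ hδ]
  have hPg : (M.law g).real (affineEst k a ⁻¹' Set.Ioi (δ * z)) = stdNormalCDF (δ - z) := by
    rw [← map_measureReal_apply (measurable_affineEst k a) measurableSet_Ioi, map_affineEst_law,
      hg, hsd, map_measureReal_apply (by fun_prop) measurableSet_Ioi,
      show δ - z = -(z - δ) by ring, stdNormalCDF_neg, stdNormalCDF_eq,
      ← probReal_compl_eq_one_sub measurableSet_Iic]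
    congr 1; ext t
    simp only [Set.mem_preimage, Set.mem_Ioi, Set.compl_Iic]
    rw [show δ ^ 2 + δ * t = δ * (δ + t) by ring, mul_lt_mul_iff_right₀ hδ, sub_lt_iff_lt_add']
  rw [← hPf] at h
  rw [← hPg]
  refine ENNReal.toReal_mono (measure_ne_top _ _) ?_
  rw [M.law_eq_withDensity f g]
  refine withDensity_apply_le_of_levelSet (M.law f)
    (C := ENNReal.ofReal (Real.exp (δ * z - M.sqDist f g / 2))) hA hR ?_ ?_
    ((ENNReal.toReal_le_toReal (measure_ne_top _ _) (measure_ne_top _ _)).1 h)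
  · intro y hy
    have : δ * z < affineEst k a y := hy
    gcongr
  · intro y hy
    have : affineEst k a y ≤ δ * z := not_lt.1 hy
    gcongr

end TEModel

/-! ### Tangent lines of concave functions. -/

theorem ConcaveOn.exists_supergradient {ω : ℝ → ℝ} {S : Set ℝ} (hω : ConcaveOn ℝ S ω) {x : ℝ}
    (hx : x ∈ interior S) : ∃ s : ℝ, ∀ y ∈ S, ω y ≤ ω x + s * (y - x) := by
  have hc : ConvexOn ℝ S (-ω) := hω.neg
  refine ⟨-derivWithin (-ω) (Set.Ioi x) x, fun y hy => ?_⟩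
  rcases lt_trichotomy y x with h | rfl | h
  · have h1 := (hc.slope_le_leftDeriv_of_mem_interior hy hx h).trans
      (hc.leftDeriv_le_rightDeriv_of_mem_interior hx)
    rw [slope_def_field, div_le_iff₀ (by linarith)] at h1
    simp only [Pi.neg_apply] at h1
    linarith
  · simp
  · have h1 := hc.rightDeriv_le_slope_of_mem_interior hx hy h
    rw [slope_def_field, le_div_iff₀ (by linarith)] at h1
    simp only [Pi.neg_apply] at h1
    linarith

/-- A nonnegative concave function on the half-line that lies below the line `c + τ * y` has, up to
`ε`, a tangent line of slope at most `τ'` and of intercept at most `c`, as soon as `τ < τ'`. -/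
theorem ConcaveOn.exists_supergradient_le {ω : ℝ → ℝ} (hω : ConcaveOn ℝ (Set.Ici 0) ω)
    (hω0 : ∀ y, 0 ≤ y → 0 ≤ ω y) {c τ τ' ε : ℝ} (hτ : 0 ≤ τ) (hττ : τ < τ') (hε : 0 < ε)
    (hle : ∀ y, 0 < y → ω y ≤ c + τ * y) :
    ∃ x > 0, ∃ s ≤ τ', (∀ y, 0 ≤ y → ω y ≤ ω x + s * (y - x)) ∧ ω x - x * s ≤ c + ε := by
  -- Close enough to 0 that τx₀ ≤ ε, so a tangent at x₀ with nonnegative slope has intercept at most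
  -- ω(x₀) ≤ c + ε.
  set x₀ := ε / (τ + 1) with hx₀
  have hx₀pos : 0 < x₀ := by positivity
  have hτx₀ : τ * x₀ ≤ ε := by
    rw [hx₀, mul_div_assoc', div_le_iff₀ (by linarith)]; nlinarith
  have hint : Set.Ioi (0 : ℝ) ⊆ interior (Set.Ici 0) := by rw [interior_Ici]
  obtain ⟨s₀, hs₀⟩ := hω.exists_supergradient (hint hx₀pos)
  have hs₀0 : 0 ≤ s₀ := by
    by_contra! hneg
    -- At this point a tangent of negative slope takes the value -1.
    have h1 := hω0 (x₀ + (ω x₀ + 1) / (-s₀)) (by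
      have := hω0 x₀ hx₀pos.le
      have : 0 ≤ (ω x₀ + 1) / (-s₀) := div_nonneg (by linarith) (by linarith)
      linarith)
    have h2 := hs₀ (x₀ + (ω x₀ + 1) / (-s₀)) (by
      have := hω0 x₀ hx₀pos.le
      have : 0 ≤ (ω x₀ + 1) / (-s₀) := div_nonneg (by linarith) (by linarith)
      simp only [Set.mem_Ici]; linarith)
    have h3 : s₀ * (x₀ + (ω x₀ + 1) / (-s₀) - x₀) = -(ω x₀ + 1) := by
      have := hneg.ne
      rw [add_sub_cancel_left]
      field_simp
    linarith
  by_cases hs : s₀ ≤ τ'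
  · refine ⟨x₀, hx₀pos, s₀, hs, fun y hy => hs₀ y hy, ?_⟩
    have := hle x₀ hx₀pos
    have := mul_nonneg hx₀pos.le hs₀0
    linarith
  push Not at hs
  -- The tangent at x₀ is too steep, so a point with tangent slope exactly τ' is sought as a
  -- maximiser of φ. It exists at or beyond x₀: φ stays below φ(x₀) far out because τ < τ', and to
  -- the left of x₀ because s₀ > τ'. Its intercept is at most c + (τ - τ')x ≤ c.
  set φ : ℝ → ℝ := fun y => ω y - τ' * y with hφ
  obtain ⟨R, hR, hφR⟩ : ∃ R ≥ x₀, ∀ y ≥ R, φ y ≤ φ x₀ := by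
    refine ⟨max x₀ ((c - φ x₀) / (τ' - τ)), le_max_left _ _, fun y hy => ?_⟩
    have h1 : (c - φ x₀) / (τ' - τ) ≤ y := (le_max_right _ _).trans hy
    rw [div_le_iff₀ (by linarith)] at h1
    have h2 := hle y (hx₀pos.trans_le ((le_max_left _ _).trans hy))
    simp only [hφ] at h1 ⊢
    linarith
  have hcont : ContinuousOn φ (Set.Icc x₀ R) := by
    have h1 : ContinuousOn ω (Set.Ioi 0) :=
      (hω.subset Set.Ioi_subset_Ici_self (convex_Ioi 0)).continuousOn isOpen_Ioi
    exact (h1.mono fun y hy => hx₀pos.trans_le hy.1).sub (by fun_prop)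
  obtain ⟨x, hx, hmax⟩ := isCompact_Icc.exists_isMaxOn (Set.nonempty_Icc.2 hR) hcont
  have hx0 : 0 < x := hx₀pos.trans_le hx.1
  have hx₀x : φ x₀ ≤ φ x := hmax (Set.left_mem_Icc.2 hR)
  refine ⟨x, hx0, τ', le_rfl, fun y hy => ?_, ?_⟩
  · suffices h : φ y ≤ φ x by simp only [hφ] at h; linarith
    rcases le_total y x₀ with hy1 | hy1
    · refine le_trans ?_ hx₀x
      have h1 := hs₀ y hy
      have h2 := mul_le_mul_of_nonpos_right hs.le (sub_nonpos.2 hy1)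
      simp only [hφ]
      linarith
    · rcases le_total y R with hy2 | hy2
      · exact hmax ⟨hy1, hy2⟩
      · exact (hφR y hy2).trans hx₀x
  · have := hle x hx0
    have := mul_le_mul_of_nonneg_right hττ.le hx0.le
    linarith

/-! ### The modulus, its extremal pairs, and the bias-variance frontier. -/

namespace TEModel

variable {X : Type*} {n : ℕ} (M : TEModel X n)

/-- The values of a function at the design points, scaled by the standard deviations. -/
noncomputable def embed : (X × Bool → ℝ) →ₗ[ℝ] EuclideanSpace ℝ (Fin n) where
  toFun f := WithLp.toLp 2 fun i => f (M.x i, M.d i) / √(M.var (M.x i, M.d i) : ℝ)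
  map_add' f g := by ext i; simp [add_div]
  map_smul' c f := by ext i; simp [mul_div_assoc]

theorem var_real_pos (i : Fin n) : (0 : ℝ) < M.var (M.x i, M.d i) := M.var_pos i

theorem sqDist_eq (f g : X × Bool → ℝ) : M.sqDist f g = ‖M.embed g - M.embed f‖ ^ 2 := by
  rw [← map_sub, EuclideanSpace.norm_sq_eq, sqDist]
  refine Finset.sum_congr rfl fun i _ => ?_
  simp only [embed, LinearMap.coe_mk, AddHom.coe_mk, Pi.sub_apply, Real.norm_eq_abs, sq_abs,
    div_pow, Real.sq_sqrt (M.var_real_pos i).le]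
  ring

theorem sqDist_le_iff {f g : X × Bool → ℝ} {δ : ℝ} (hδ : 0 ≤ δ) :
    M.sqDist f g ≤ δ ^ 2 ↔ ‖M.embed g - M.embed f‖ ≤ δ := by
  rw [sqDist_eq, sq_le_sq₀ (norm_nonneg _) hδ]

theorem L_combo (a b : ℝ) (f g : X × Bool → ℝ) : M.L (a • f + b • g) = a * M.L f + b * M.L g := by
  simp only [L, Finset.mul_sum, ← Finset.sum_add_distrib, Pi.add_apply, Pi.smul_apply, smul_eq_mul]
  exact Finset.sum_congr rfl fun i _ => by ring

theorem L_add (f g : X × Bool → ℝ) : M.L (f + g) = M.L f + M.L g := by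
  simpa using M.L_combo 1 1 f g

theorem optWeights_sum (δ s : ℝ) (f g h : X × Bool → ℝ) :
    ∑ i, M.optWeights δ s f g i * h (M.x i, M.d i)
      = s / δ * inner ℝ (M.embed g - M.embed f) (M.embed h) := by
  rw [← map_sub, PiLp.inner_apply, Finset.mul_sum]
  refine Finset.sum_congr rfl fun i _ => ?_
  simp only [embed, optWeights, LinearMap.coe_mk, AddHom.coe_mk, Pi.sub_apply, RCLike.inner_apply,
    conj_trivial]
  have h1 := Real.mul_self_sqrt (M.var_real_pos i).le
  have h2 := Real.sqrt_pos.2 (M.var_real_pos i)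
  nth_rewrite 1 [← h1]
  field_simp

theorem sum_mul_sub_le (k : Fin n → ℝ) (f g : X × Bool → ℝ) :
    ∑ i, k i * (g (M.x i, M.d i) - f (M.x i, M.d i))
      ≤ M.sd k * ‖M.embed g - M.embed f‖ := by
  rw [← map_sub]
  set κ : EuclideanSpace ℝ (Fin n) :=
    WithLp.toLp 2 fun i => k i * √(M.var (M.x i, M.d i) : ℝ) with hκ
  have h1 : ‖κ‖ = M.sd k := by
    rw [EuclideanSpace.norm_eq, sd]
    congr 1
    refine Finset.sum_congr rfl fun i _ => ?_
    simp [hκ, mul_pow]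
  have h2 : ∑ i, k i * (g (M.x i, M.d i) - f (M.x i, M.d i)) = inner ℝ κ (M.embed (g - f)) := by
    rw [PiLp.inner_apply]
    refine Finset.sum_congr rfl fun i _ => ?_
    have := Real.sqrt_pos.2 (M.var_real_pos i)
    simp only [hκ, embed, LinearMap.coe_mk, AddHom.coe_mk, Pi.sub_apply, RCLike.inner_apply,
      conj_trivial]
    field_simp
  rw [h2, ← h1]
  exact real_inner_le_norm _ _

variable {M} {F : Set (X × Bool → ℝ)} {δ s : ℝ} {f g : X × Bool → ℝ}

theorem AttainsModulus.modulus_eq (h : M.AttainsModulus F δ f g) :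
    M.modulus F δ = M.L g - M.L f := by
  refine IsGreatest.csSup_eq ⟨⟨f, h.1, g, h.2.1, h.2.2.1, rfl⟩, ?_⟩
  rintro r ⟨f', hf', g', hg', hd, rfl⟩
  exact h.2.2.2 f' hf' g' hg' hd

/-- Shrinking any pair towards `f` by the factor δ/(δ + δ') brings it within distance δ, where the
extremal pair bounds it. Thus the `sSup` in the modulus is a genuine supremum at every radius. -/
theorem AttainsModulus.bddAbove (hF : Convex ℝ F) (hδ : 0 < δ) (h : M.AttainsModulus F δ f g)
    {δ' : ℝ} (hδ' : 0 ≤ δ') :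
    BddAbove {r : ℝ | ∃ f ∈ F, ∃ g ∈ F, M.sqDist f g ≤ δ' ^ 2 ∧ r = M.L g - M.L f} := by
  set t := δ / (δ + δ') with ht
  have ht0 : 0 < t := by positivity
  have ht1 : t ≤ 1 := (div_le_one (by positivity)).2 (by linarith)
  have htδ : t * δ' ≤ δ := by
    rw [ht, div_mul_eq_mul_div, div_le_iff₀ (by positivity)]; nlinarith
  refine ⟨(M.L g - M.L f) / t, ?_⟩
  rintro r ⟨f', hf', g', hg', hd, rfl⟩
  rw [sqDist_le_iff M hδ'] at hd
  have h1 := h.2.2.2 ((1 - t) • f + t • f') (hF h.1 hf' (by linarith) ht0.le (by ring))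
    ((1 - t) • f + t • g') (hF h.1 hg' (by linarith) ht0.le (by ring)) (by
      rw [sqDist_le_iff M hδ.le, ← map_sub, add_sub_add_left_eq_sub, ← smul_sub, map_smul,
        norm_smul, Real.norm_of_nonneg ht0.le, map_sub]
      exact (mul_le_mul_of_nonneg_left hd ht0.le).trans htδ)
  rw [L_combo, L_combo] at h1
  rw [le_div_iff₀ ht0]
  linarith

theorem AttainsModulus.sub_le_modulus (hF : Convex ℝ F) (hδ : 0 < δ)
    (h : M.AttainsModulus F δ f g) {δ' : ℝ} {f' g' : X × Bool → ℝ} (hf' : f' ∈ F) (hg' : g' ∈ F)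
    (hd : ‖M.embed g' - M.embed f'‖ ≤ δ') : M.L g' - M.L f' ≤ M.modulus F δ' :=
  have hδ' := (norm_nonneg _).trans hd
  le_csSup (h.bddAbove hF hδ hδ') ⟨f', hf', g', hg', (sqDist_le_iff M hδ').2 hd, rfl⟩

theorem AttainsModulus.modulus_nonneg (hF : Convex ℝ F) (hδ : 0 < δ)
    (h : M.AttainsModulus F δ f g) {δ' : ℝ} (hδ' : 0 ≤ δ') : 0 ≤ M.modulus F δ' := by
  have := h.sub_le_modulus hF hδ (δ' := δ') h.1 h.1 (by simpa using hδ')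
  simpa using this

theorem modulus_le (hne : F.Nonempty) {δ' : ℝ} (hδ' : 0 ≤ δ') {c : ℝ}
    (h : ∀ f ∈ F, ∀ g ∈ F, ‖M.embed g - M.embed f‖ ≤ δ' → M.L g - M.L f ≤ c) :
    M.modulus F δ' ≤ c := by
  obtain ⟨f, hf⟩ := hne
  refine csSup_le ⟨_, f, hf, f, hf, (sqDist_le_iff M hδ').2 (by simpa using hδ'), rfl⟩ ?_
  rintro r ⟨f', hf', g', hg', hd, rfl⟩
  exact h f' hf' g' hg' ((sqDist_le_iff M hδ').1 hd)

/-- A convex combination of two pairs is a pair in the class, with difference bounded by the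
combined radius; the suprema over the two pairs are then taken one at a time. -/
theorem AttainsModulus.concaveOn (hF : Convex ℝ F) (hδ : 0 < δ) (h : M.AttainsModulus F δ f g) :
    ConcaveOn ℝ (Set.Ici 0) (M.modulus F) := by
  refine ⟨convex_Ici 0, fun x hx y hy a b ha hb hab => ?_⟩
  simp only [Set.mem_Ici] at hx hy
  simp only [smul_eq_mul]
  have key : ∀ f₁ ∈ F, ∀ g₁ ∈ F, ‖M.embed g₁ - M.embed f₁‖ ≤ x →
      ∀ f₂ ∈ F, ∀ g₂ ∈ F, ‖M.embed g₂ - M.embed f₂‖ ≤ y →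
      a * (M.L g₁ - M.L f₁) + b * (M.L g₂ - M.L f₂) ≤ M.modulus F (a * x + b * y) := by
    intro f₁ hf₁ g₁ hg₁ h₁ f₂ hf₂ g₂ hg₂ h₂
    have h3 := h.sub_le_modulus hF hδ (δ' := a * x + b * y) (hF hf₁ hf₂ ha hb hab)
      (hF hg₁ hg₂ ha hb hab) (by
        have : M.embed (a • g₁ + b • g₂) - M.embed (a • f₁ + b • f₂)
            = a • (M.embed g₁ - M.embed f₁) + b • (M.embed g₂ - M.embed f₂) := by
          simp only [map_add, map_smul]; module
        rw [this]
        refine (norm_add_le _ _).trans ?_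
        rw [norm_smul, norm_smul, Real.norm_of_nonneg ha, Real.norm_of_nonneg hb]
        gcongr)
    rw [L_combo, L_combo] at h3
    linarith
  have scale : ∀ c : ℝ, 0 ≤ c → ∀ z, 0 ≤ z → ∀ B : ℝ, 0 ≤ B →
      (∀ f ∈ F, ∀ g ∈ F, ‖M.embed g - M.embed f‖ ≤ z → c * (M.L g - M.L f) ≤ B) →
      c * M.modulus F z ≤ B := by
    intro c hc z hz B hB hle
    rcases hc.eq_or_lt with rfl | hc
    · simpa using hB
    · rw [← le_div_iff₀' hc]
      refine modulus_le ⟨f, h.1⟩ hz fun f hf g hg hd => ?_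
      rw [le_div_iff₀' hc]
      exact hle f hf g hg hd
  suffices hs : a * M.modulus F x ≤ M.modulus F (a * x + b * y) - b * M.modulus F y by linarith
  have hby : ∀ f₁ ∈ F, ∀ g₁ ∈ F, ‖M.embed g₁ - M.embed f₁‖ ≤ x →
      b * M.modulus F y ≤ M.modulus F (a * x + b * y) - a * (M.L g₁ - M.L f₁) := by
    intro f₁ hf₁ g₁ hg₁ h₁
    refine scale b hb y hy _ ?_ fun f₂ hf₂ g₂ hg₂ h₂ => ?_
    · have := key f₁ hf₁ g₁ hg₁ h₁ f h.1 f h.1 (by simpa using hy)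
      linarith
    · linarith [key f₁ hf₁ g₁ hg₁ h₁ f₂ hf₂ g₂ hg₂ h₂]
  refine scale a ha x hx _ ?_ fun f₁ hf₁ g₁ hg₁ h₁ => ?_
  · have := hby f h.1 f h.1 (by simpa using hx)
    linarith
  · linarith [hby f₁ hf₁ g₁ hg₁ h₁]

theorem AttainsModulus.superdiff_nonneg (hF : Convex ℝ F) (hδ : 0 < δ)
    (h : M.AttainsModulus F δ f g) (hs : s ∈ M.superdiff F δ) : 0 ≤ s := by
  have h1 := hs (δ + 1) (by linarith)
  have h2 := h.sub_le_modulus hF hδ (δ' := δ + 1) h.1 h.2.1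
    (((sqDist_le_iff M hδ.le).1 h.2.2.1).trans (by linarith))
  rw [← h.modulus_eq] at h2
  linarith

/-- If the pair is closer than δ, ω takes the same value at the smaller distance, which forces `s =
0`. Hence (ii) and (iii) need no assumption that the distance constraint binds. -/
theorem AttainsModulus.mul_norm_eq (hF : Convex ℝ F) (hδ : 0 < δ)
    (h : M.AttainsModulus F δ f g) (hs : s ∈ M.superdiff F δ) :
    s * ‖M.embed g - M.embed f‖ = s * δ := by
  have hs0 := h.superdiff_nonneg hF hδ hs
  have h1 := hs ‖M.embed g - M.embed f‖ (norm_nonneg _)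
  have h2 := h.sub_le_modulus hF hδ h.1 h.2.1 le_rfl
  rw [← h.modulus_eq] at h2
  have h3 := mul_le_mul_of_nonneg_left ((sqDist_le_iff M hδ.le).1 h.2.2.1) hs0
  linarith

theorem AttainsModulus.sd_optWeights (hF : Convex ℝ F) (hδ : 0 < δ)
    (h : M.AttainsModulus F δ f g) (hs : s ∈ M.superdiff F δ) :
    M.sd (M.optWeights δ s f g) = s := by
  have hs0 := h.superdiff_nonneg hF hδ hs
  rw [← sq_eq_sq₀ (M.sd_nonneg _) hs0, sd_sq]
  have h1 : ∑ i, M.optWeights δ s f g i ^ 2 * (M.var (M.x i, M.d i) : ℝ)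
      = (s / δ) ^ 2 * M.sqDist f g := by
    rw [sqDist, Finset.mul_sum]
    refine Finset.sum_congr rfl fun i _ => ?_
    have := (M.var_real_pos i).ne'
    simp only [optWeights]
    field_simp
    ring
  rw [h1, sqDist_eq, div_pow, div_mul_eq_mul_div, ← mul_pow, h.mul_norm_eq hF hδ hs, mul_pow]
  field_simp

theorem affineBias_optWeights (h' : X × Bool → ℝ) :
    M.affineBias (M.optWeights δ s f g) (M.optCenter δ s f g) h'
      = 1 / 2 * (M.L f + M.L g
          - s / δ * inner ℝ (M.embed g - M.embed f) (M.embed f + M.embed g))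
        + s / δ * inner ℝ (M.embed g - M.embed f) (M.embed h') - M.L h' := by
  have h1 : ∑ i, M.optWeights δ s f g i * (f (M.x i, M.d i) + g (M.x i, M.d i))
      = s / δ * inner ℝ (M.embed g - M.embed f) (M.embed f + M.embed g) := by
    rw [← map_add, ← optWeights_sum]; rfl
  rw [affineBias, optCenter, h1, optWeights_sum, L_add]

theorem AttainsModulus.inner_self_eq (hF : Convex ℝ F) (hδ : 0 < δ)
    (h : M.AttainsModulus F δ f g) (hs : s ∈ M.superdiff F δ) :
    s / δ * inner ℝ (M.embed g - M.embed f) (M.embed g)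
      - s / δ * inner ℝ (M.embed g - M.embed f) (M.embed f) = δ * s := by
  rw [← mul_sub, ← inner_sub_right, real_inner_self_eq_norm_mul_norm, div_mul_eq_mul_div,
    ← mul_assoc, h.mul_norm_eq hF hδ hs, mul_right_comm, h.mul_norm_eq hF hδ hs]
  field_simp

theorem AttainsModulus.affineBias_left (hF : Convex ℝ F) (hδ : 0 < δ)
    (h : M.AttainsModulus F δ f g) (hs : s ∈ M.superdiff F δ) :
    M.affineBias (M.optWeights δ s f g) (M.optCenter δ s f g) f
      = (M.modulus F δ - δ * s) / 2 := by
  rw [affineBias_optWeights, inner_add_right, h.modulus_eq]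
  linarith [h.inner_self_eq hF hδ hs]

theorem le_of_forall_le_add_mul {a b c : ℝ} (h : ∀ t : ℝ, 0 < t → t ≤ 1 → a ≤ b + t * c) :
    a ≤ b := by
  by_contra! hab
  have hc : 0 < |c| + 1 := by positivity
  set t := min 1 ((a - b) / (2 * (|c| + 1))) with ht
  have ht0 : 0 < t := lt_min one_pos (div_pos (by linarith) (by linarith))
  have h1 := h t ht0 (min_le_left _ _)
  have h2 : t * (2 * (|c| + 1)) ≤ a - b := by
    rw [← le_div_iff₀ (by linarith)]; exact min_le_right _ _
  have h3 : t * c ≤ t * (|c| + 1) :=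
    mul_le_mul_of_nonneg_left (by linarith [le_abs_self c]) ht0.le
  linarith

/-- First order condition for an extremal pair: `u` is the difference of the pair, `w` the direction
in which one of its members moves within the class. -/
theorem sub_le_of_supergradient {E : Type*} [NormedAddCommGroup E] [InnerProductSpace ℝ E]
    {u w : E} {s δ c : ℝ} (hδ : 0 < δ) (hs : 0 ≤ s) (hu : ‖u‖ ≤ δ)
    (h : ∀ t : ℝ, 0 < t → t ≤ 1 → t * c ≤ s * (‖u + t • w‖ - δ)) :
    c ≤ s / δ * inner ℝ u w := by
  refine le_of_forall_le_add_mul (c := s / (2 * δ) * ‖w‖ ^ 2) fun t ht ht1 => ?_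
  have h1 := h t ht ht1
  -- Expanding (‖u + tw‖ - δ)² ≥ 0 trades the norm for its square, a polynomial in t, so the norm
  -- need not be differentiated.
  have h2 : ‖u + t • w‖ - δ ≤ (‖u + t • w‖ ^ 2 - δ ^ 2) / (2 * δ) := by
    rw [le_div_iff₀ (by linarith)]; nlinarith [sq_nonneg (‖u + t • w‖ - δ)]
  have h3 : ‖u + t • w‖ ^ 2 - δ ^ 2 ≤ 2 * (t * inner ℝ u w) + t ^ 2 * ‖w‖ ^ 2 := by
    rw [norm_add_sq_real, inner_smul_right, norm_smul, Real.norm_of_nonneg ht.le, mul_pow]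
    have := (sq_le_sq₀ (norm_nonneg u) hδ.le).2 hu
    linarith
  have h4 : t * c ≤ s * ((2 * (t * inner ℝ u w) + t ^ 2 * ‖w‖ ^ 2) / (2 * δ)) :=
    h1.trans (mul_le_mul_of_nonneg_left (h2.trans (by gcongr)) hs)
  have h5 : s * ((2 * (t * inner ℝ u w) + t ^ 2 * ‖w‖ ^ 2) / (2 * δ))
      = t * (s / δ * inner ℝ u w + t * (s / (2 * δ) * ‖w‖ ^ 2)) := by
    field_simp
  rw [h5] at h4
  exact le_of_mul_le_mul_left h4 ht

/-- Moving `g` towards `h'` shows that the bias is smallest at `g`; moving `f` towards `h'` shows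
that it is largest at `f`. The centering makes these two extremes opposite. -/
theorem AttainsModulus.affineBias_abs_le (hF : Convex ℝ F) (hδ : 0 < δ)
    (h : M.AttainsModulus F δ f g) (hs : s ∈ M.superdiff F δ) {h' : X × Bool → ℝ} (hh : h' ∈ F) :
    |M.affineBias (M.optWeights δ s f g) (M.optCenter δ s f g) h'|
      ≤ (M.modulus F δ - δ * s) / 2 := by
  have hs0 := h.superdiff_nonneg hF hδ hs
  have hu := (sqDist_le_iff M hδ.le).1 h.2.2.1
  have key1 : M.L h' - M.L g
      ≤ s / δ * inner ℝ (M.embed g - M.embed f) (M.embed h' - M.embed g) := by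
    refine sub_le_of_supergradient hδ hs0 hu fun t ht ht1 => ?_
    have h1 := h.sub_le_modulus hF hδ (f' := f) (g' := (1 - t) • g + t • h') h.1
      (hF h.2.1 hh (by linarith) ht.le (by ring)) le_rfl
    have h2 : M.embed ((1 - t) • g + t • h') - M.embed f
        = M.embed g - M.embed f + t • (M.embed h' - M.embed g) := by
      simp only [map_add, map_smul]; module
    rw [h2, L_combo] at h1
    have h3 := hs _ (norm_nonneg (M.embed g - M.embed f + t • (M.embed h' - M.embed g)))
    rw [h.modulus_eq] at h3
    linarith
  have key2 : M.L f - M.L h'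
      ≤ s / δ * inner ℝ (M.embed g - M.embed f) (M.embed f - M.embed h') := by
    refine sub_le_of_supergradient hδ hs0 hu fun t ht ht1 => ?_
    have h1 := h.sub_le_modulus hF hδ (f' := (1 - t) • f + t • h') (g' := g)
      (hF h.1 hh (by linarith) ht.le (by ring)) h.2.1 le_rfl
    have h2 : M.embed g - M.embed ((1 - t) • f + t • h')
        = M.embed g - M.embed f + t • (M.embed f - M.embed h') := by
      simp only [map_add, map_smul]; module
    rw [h2, L_combo] at h1
    have h3 := hs _ (norm_nonneg (M.embed g - M.embed f + t • (M.embed f - M.embed h')))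
    rw [h.modulus_eq] at h3
    linarith
  rw [inner_sub_right] at key1 key2
  have h3 := h.inner_self_eq hF hδ hs
  rw [affineBias_optWeights, inner_add_right, h.modulus_eq, abs_le]
  constructor <;> linarith

theorem AttainsModulus.maxBias_eq (hF : Convex ℝ F) (hδ : 0 < δ)
    (h : M.AttainsModulus F δ f g) (hs : s ∈ M.superdiff F δ) :
    M.maxBias F (M.optEst δ s f g) = (((M.modulus F δ - δ * s) / 2 : ℝ) : EReal) := by
  unfold maxBias optEst
  simp only [bias_affineEst]
  refine le_antisymm (iSup₂_le fun h' hh => ?_) ?_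
  · exact_mod_cast (le_abs_self _).trans (h.affineBias_abs_le hF hδ hs hh)
  · rw [← h.affineBias_left hF hδ hs]
    exact le_iSup₂ (f := fun (e : X × Bool → ℝ) (_ : e ∈ F) =>
      ((M.affineBias (M.optWeights δ s f g) (M.optCenter δ s f g) e : ℝ) : EReal)) f h.1

/-- The bias-variance frontier: an affine estimator with bias at most `b` bounds the modulus. -/
theorem modulus_le_of_affineBias_le (hne : F.Nonempty) {k : Fin n → ℝ} {a b : ℝ}
    (hb : ∀ f ∈ F, |M.affineBias k a f| ≤ b) {δ' : ℝ} (hδ' : 0 ≤ δ') :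
    M.modulus F δ' ≤ 2 * b + M.sd k * δ' := by
  refine modulus_le hne hδ' fun f hf g hg hd => ?_
  have h1 := (abs_le.1 (hb f hf)).2
  have h2 := (abs_le.1 (hb g hg)).1
  have h3 := (M.sum_mul_sub_le k f g).trans (mul_le_mul_of_nonneg_left hd (M.sd_nonneg k))
  simp only [mul_sub, Finset.sum_sub_distrib] at h3
  unfold affineBias at h1 h2
  linarith

/-- Every affine estimator is nearly dominated by a tangent of ω. Slack in both coordinates is
needed, since the best tangent may touch only at 0 or at infinity. -/
theorem AttainsModulus.exists_superdiff_le (hF : Convex ℝ F) (hδ : 0 < δ)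
    (h : M.AttainsModulus F δ f g) {k : Fin n → ℝ} {a b τ ε : ℝ}
    (hb : ∀ f ∈ F, |M.affineBias k a f| ≤ b) (hτ : M.sd k < τ) (hε : 0 < ε) :
    ∃ δ' > 0, ∃ s ∈ M.superdiff F δ', 0 ≤ s ∧ s ≤ τ ∧ 0 ≤ M.modulus F δ' - δ' * s ∧
      (M.modulus F δ' - δ' * s) / 2 ≤ b + ε := by
  obtain ⟨x, hx, s, hsτ, hs, hle⟩ := (h.concaveOn hF hδ).exists_supergradient_le
    (fun y hy => h.modulus_nonneg hF hδ hy) (M.sd_nonneg k) hτ (by positivity : 0 < 2 * ε)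
    fun y hy => modulus_le_of_affineBias_le ⟨f, h.1⟩ hb hy.le
  have h0 := hs 0 le_rfl
  have h1 := h.modulus_nonneg hF hδ (le_refl 0)
  refine ⟨x, hx, s, hs, ?_, hsτ, by linarith, by linarith⟩
  have h2 := hs (x + 1) (by linarith)
  have h3 : M.modulus F x ≤ M.modulus F (x + 1) := by
    refine modulus_le ⟨f, h.1⟩ hx.le fun f' hf' g' hg' hd => ?_
    exact h.sub_le_modulus hF hδ hf' hg' (hd.trans (by linarith))
  linarith

end TEModel

/-! ### Optimality of the one-sided interval, the fixed-length interval and the estimator. -/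

namespace TEModel

variable {X : Type*} {n : ℕ} {M : TEModel X n} {F : Set (X × Bool → ℝ)} {δ s : ℝ}
  {f g : X × Bool → ℝ}

theorem AttainsModulus.halfBias_nonneg (hF : Convex ℝ F) (hδ : 0 < δ)
    (h : M.AttainsModulus F δ f g) (hs : s ∈ M.superdiff F δ) :
    0 ≤ (M.modulus F δ - δ * s) / 2 := by
  have h1 := hs 0 le_rfl
  have h2 := h.modulus_nonneg hF hδ (le_refl 0)
  linarith

theorem AttainsModulus.isLowerCI (hF : Convex ℝ F) {α : ℝ} (hα0 : 0 < α) (hα1 : α < 1)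
    (hδ : 0 < δ) (h : M.AttainsModulus F δ f g) (hs : s ∈ M.superdiff F δ) :
    M.IsLowerCI F α (fun y => M.optEst δ s f g y - (M.modulus F δ - δ * s) / 2
      - zQuantile (1 - α) * M.sd (M.optWeights δ s f g)) := by
  rw [h.sd_optWeights hF hδ hs]
  refine ⟨((measurable_affineEst _ _).sub_const _).sub_const _, fun f' hf' => ?_⟩
  have h1 := M.law_real_preimage f' (M.optWeights δ s f g) (M.optCenter δ s f g)
    (measurableSet_Iic (a := (M.modulus F δ - δ * s) / 2 + zQuantile (1 - α) * s))
  have h2 : 1 - α = (gaussianReal 0 1).real (Set.Iic (zQuantile (1 - α))) := by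
    rw [← stdNormalCDF_eq, stdNormalCDF_zQuantile (by linarith) (by linarith)]
  rw [h.sd_optWeights hF hδ hs] at h1
  have h3 : {y | M.optEst δ s f g y - (M.modulus F δ - δ * s) / 2 - zQuantile (1 - α) * s
      ≤ M.L f'} = {y | affineEst (M.optWeights δ s f g) (M.optCenter δ s f g) y - M.L f'
        ∈ Set.Iic ((M.modulus F δ - δ * s) / 2 + zQuantile (1 - α) * s)} := by
    ext y
    simp only [Set.mem_ofPred_eq, Set.mem_Iic, optEst]
    constructor <;> intro h <;> linarith
  rw [h3, h1]
  refine h2.le.trans (measureReal_mono fun t ht => ?_)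
  have h4 := (le_abs_self _).trans (h.affineBias_abs_le hF hδ hs hf')
  have h5 := mul_le_mul_of_nonneg_left (show t ≤ zQuantile (1 - α) from ht)
    (h.superdiff_nonneg hF hδ hs)
  simp only [Set.mem_ofPred_eq, Set.mem_Iic]
  linarith

theorem sd_neg (M : TEModel X n) (k : Fin n → ℝ) : M.sd (-k) = M.sd k := by
  simp [sd]

/-- With B the worst bias, the excess length is normal with mean at most 2B + zs and standard
deviation s; its Φ(δ - z) quantile is at most 2B + zs + s(δ - z) = ω(δ). -/
theorem AttainsModulus.excessQuantile_le (hF : Convex ℝ F) (hδ : 0 < δ)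
    (h : M.AttainsModulus F δ f g) (hs : s ∈ M.superdiff F δ) (z : ℝ) :
    M.excessQuantile (stdNormalCDF (δ - z))
      (fun y => M.optEst δ s f g y - (M.modulus F δ - δ * s) / 2
        - z * M.sd (M.optWeights δ s f g)) F ≤ (M.modulus F δ : EReal) := by
  refine iSup₂_le fun g' hg' => ?_
  have h1 : (fun y => M.L g' - (M.optEst δ s f g y - (M.modulus F δ - δ * s) / 2
        - z * M.sd (M.optWeights δ s f g)))
      = affineEst (-M.optWeights δ s f g) (M.L g' - M.optCenter δ s f g
        + (M.modulus F δ - δ * s) / 2 + z * M.sd (M.optWeights δ s f g)) := by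
    ext y
    simp only [optEst, affineEst, Pi.neg_apply, neg_mul, Finset.sum_neg_distrib]
    ring
  rw [h1, map_affineEst_law, lawQuantile_affine _ (M.sd_nonneg _), sd_neg,
    h.sd_optWeights hF hδ hs, EReal.coe_le_coe_iff]
  have h2 := (abs_le.1 (h.affineBias_abs_le hF hδ hs hg')).1
  simp only [affineBias] at h2
  simp only [Pi.neg_apply, neg_mul, Finset.sum_neg_distrib]
  linarith

theorem AttainsModulus.le_excessQuantile (hF : Convex ℝ F) {α : ℝ} (hα0 : 0 < α) (hα1 : α < 1)
    (hδ : 0 < δ) (h : M.AttainsModulus F δ f g) (hfg : M.sqDist f g = δ ^ 2)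
    {c : (Fin n → ℝ) → ℝ} (hc : M.IsLowerCI F α c) :
    (M.modulus F δ : EReal)
      ≤ M.excessQuantile (stdNormalCDF (δ - zQuantile (1 - α))) c F := by
  refine le_trans ?_ (le_iSup₂ (f := fun (e : X × Bool → ℝ) (_ : e ∈ F) => ((lawQuantile
    ((M.law e).map fun y => M.L e - c y) (stdNormalCDF (δ - zQuantile (1 - α))) : ℝ) : EReal))
    g h.2.1)
  rw [EReal.coe_le_coe_iff]
  by_contra! hlt
  set ω := M.modulus F δ with hω
  set t := lawQuantile ((M.law g).map fun y => M.L g - c y)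
    (stdNormalCDF (δ - zQuantile (1 - α))) with ht
  have hω0 : 0 ≤ ω := h.modulus_nonneg hF hδ hδ.le
  have hmeas : Measurable fun y => M.L g - c y := hc.1.const_sub _
  have hprob := Measure.isProbabilityMeasure_map (μ := M.law g) hmeas.aemeasurable
  have h1 := (lawQuantile_le_iff _ (stdNormalCDF_pos _) (stdNormalCDF_lt_one _)).1 ht.ge
  rw [map_measureReal_apply hmeas measurableSet_Iic] at h1
  have hD : 0 < ω - t + ω + 1 := by linarith
  -- Testing `f` itself against `g` would only bound the power by the level β, no contradiction.
  -- Moving `f` by a fraction ε towards `g` makes the bound strict; εω < ω - t keeps the event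
  -- inside the non-coverage event at the moved point.
  set ε := (ω - t) / (ω - t + ω + 1) with hε
  have hε0 : 0 < ε := div_pos (by linarith) hD
  have hε1 : ε < 1 := (div_lt_one hD).2 (by linarith)
  have hεω : ε * ω < ω - t := by
    rw [hε, div_mul_eq_mul_div, div_lt_iff₀ hD]
    nlinarith
  have hmem : (1 - ε) • f + ε • g ∈ F := hF h.1 h.2.1 (by linarith) hε0.le (by ring)
  have hL : M.L ((1 - ε) • f + ε • g) < M.L g - t := by
    rw [L_combo]
    rw [hω, h.modulus_eq] at hεω
    linarith
  have hA : MeasurableSet ((fun y => M.L g - c y) ⁻¹' Set.Iic t) := hmeas measurableSet_Iic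
  have hlevel : (M.law ((1 - ε) • f + ε • g)).real ((fun y => M.L g - c y) ⁻¹' Set.Iic t)
      ≤ 1 - stdNormalCDF (zQuantile (1 - α)) := by
    rw [stdNormalCDF_zQuantile (by linarith) (by linarith)]
    have h2 := hc.2 _ hmem
    have h3 : MeasurableSet {y | c y ≤ M.L ((1 - ε) • f + ε • g)} :=
      measurableSet_le hc.1 measurable_const
    have h4 := probReal_compl_eq_one_sub (μ := M.law ((1 - ε) • f + ε • g)) h3
    have h5 : (M.law ((1 - ε) • f + ε • g)).real ((fun y => M.L g - c y) ⁻¹' Set.Iic t)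
        ≤ (M.law ((1 - ε) • f + ε • g)).real {y | c y ≤ M.L ((1 - ε) • f + ε • g)}ᶜ := by
      refine measureReal_mono fun y hy => ?_
      simp only [Set.mem_preimage, Set.mem_Iic] at hy
      simp only [Set.mem_compl_iff, Set.mem_ofPred_eq, not_le]
      linarith
    linarith
  have hdist : M.sqDist ((1 - ε) • f + ε • g) g = ((1 - ε) * δ) ^ 2 := by
    have h2 : M.embed g - M.embed ((1 - ε) • f + ε • g) = (1 - ε) • (M.embed g - M.embed f) := by
      simp only [map_add, map_smul]; module
    rw [mul_pow, ← hfg, sqDist_eq, sqDist_eq, h2, norm_smul, mul_pow, Real.norm_eq_abs, sq_abs]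
  have h2 := M.law_real_le_stdNormalCDF (mul_pos (by linarith) hδ) hdist hA hlevel
  have h3 : stdNormalCDF ((1 - ε) * δ - zQuantile (1 - α))
      < stdNormalCDF (δ - zQuantile (1 - α)) :=
    stdNormalCDF_strictMono (by nlinarith)
  linarith

theorem flciCriterion_eq (α : ℝ) (h : 0 ≤ M.modulus F δ - δ * s) :
    M.flciCriterion F α δ s = flciHalfLength α ((M.modulus F δ - δ * s) / 2) s := by
  unfold flciCriterion flciHalfLength
  split_ifs with h0
  · subst h0
    rw [mul_zero, sub_zero] at h ⊢
    rw [abs_of_nonneg (by linarith)]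
  · congr 2
    field_simp

theorem AttainsModulus.isFLCI (hF : Convex ℝ F) {α : ℝ} (hα0 : 0 < α) (hα1 : α < 1)
    (hδ : 0 < δ) (h : M.AttainsModulus F δ f g) (hs : s ∈ M.superdiff F δ) :
    M.IsFLCI F α (M.optEst δ s f g) (flciHalfLength α ((M.modulus F δ - δ * s) / 2)
      (M.sd (M.optWeights δ s f g))) := by
  refine (M.isFLCI_affineEst_iff F α _ _ _).2 fun f' hf' => ?_
  exact ((flciHalfLength_le_iff hα0 hα1 _ _ (M.sd_nonneg _)).1 le_rfl).anti_bias hα1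
    (M.sd_nonneg _) (h.affineBias_abs_le hF hδ hs hf')

/-- An affine fixed-length interval that covers for every bias also covers for their supremum. -/
theorem covers_sSup_abs {S : Set ℝ} (hS : S.Nonempty) {α τ χ : ℝ} (hα0 : 0 < α) (hα : α ≤ 1 / 2)
    (hτ : 0 ≤ τ) (h : ∀ b ∈ S, Covers α b τ χ) :
    ∃ b₀, (∀ b ∈ S, |b| ≤ b₀) ∧ Covers α b₀ τ χ := by
  have hα1 : α < 1 := by linarith
  have hbdd : BddAbove ((fun b : ℝ => |b|) '' S) := by
    refine ⟨χ, ?_⟩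
    rintro _ ⟨b, hb, rfl⟩
    exact (h b hb).abs_le hα hτ
  refine ⟨sSup ((fun b : ℝ => |b|) '' S), fun b hb => le_csSup hbdd ⟨b, hb, rfl⟩, ?_⟩
  rw [← flciHalfLength_le_iff hα0 hα1 _ _ hτ]
  refine le_of_forall_pos_le_add fun ε hε => ?_
  rw [flciHalfLength_le_iff hα0 hα1 _ _ hτ]
  -- The supremum need not be attained: a bias within ε of it covers, and widening by ε absorbs the
  -- gap.
  obtain ⟨_, ⟨b, hb, rfl⟩, hlt⟩ := exists_lt_of_lt_csSup (hS.image _)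
    (sub_lt_self (sSup ((fun b : ℝ => |b|) '' S)) hε)
  refine ((h b hb).abs.add hε.le).anti_bias hα1 hτ ?_
  rw [abs_of_nonneg (Real.sSup_nonneg (by rintro _ ⟨b, -, rfl⟩; exact abs_nonneg b))]
  linarith

theorem AttainsModulus.flciCriterion_le (hF : Convex ℝ F) {α : ℝ} (hα0 : 0 < α)
    (hα : α ≤ 1 / 2) (hδ : 0 < δ) (h : M.AttainsModulus F δ f g)
    (hmin : ∀ δ' : ℝ, 0 < δ' → ∀ s' ∈ M.superdiff F δ',
      M.flciCriterion F α δ s ≤ M.flciCriterion F α δ' s')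
    {k : Fin n → ℝ} {a χ : ℝ} (hk : M.IsFLCI F α (affineEst k a) χ) :
    M.flciCriterion F α δ s ≤ χ := by
  have hα1 : α < 1 := by linarith
  rw [isFLCI_affineEst_iff] at hk
  obtain ⟨b₀, hb₀, hcov⟩ := covers_sSup_abs (S := M.affineBias k a '' F)
    (Set.Nonempty.image _ ⟨f, h.1⟩)
    hα0 hα (M.sd_nonneg k) (by rintro _ ⟨f', hf', rfl⟩; exact hk f' hf')
  refine le_of_forall_pos_le_add fun ε hε => ?_
  -- Half of ε pays for the larger standard deviation, the other half for the larger bias.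
  obtain ⟨τ, hτ, hcovτ⟩ := exists_covers_gt hα0 hα1 (M.sd_nonneg k) (half_pos hε) hcov
  obtain ⟨δ', hδ', s', hs', hs0, hsτ, hB0, hB⟩ := h.exists_superdiff_le hF hδ (k := k) (a := a)
    (fun f' hf' => hb₀ _ ⟨f', hf', rfl⟩) hτ (half_pos hε)
  refine (hmin δ' hδ' s' hs').trans ?_
  rw [flciCriterion_eq α hB0, flciHalfLength_le_iff hα0 hα1 _ _ hs0]
  have h1 := ((hcovτ.add (half_pos hε).le).anti_sd hα hs0 hsτ).anti_bias hα1 hs0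
    (b := (M.modulus F δ' - δ' * s') / 2) (by rwa [abs_of_nonneg (by linarith)])
  exact h1.mono (by linarith)

theorem AttainsModulus.rmseCriterion_le (hF : Convex ℝ F) (hδ : 0 < δ)
    (h : M.AttainsModulus F δ f g)
    (hmin : ∀ δ' : ℝ, 0 < δ' → ∀ s' ∈ M.superdiff F δ',
      M.rmseCriterion F δ s ≤ M.rmseCriterion F δ' s')
    {k : Fin n → ℝ} {a b : ℝ} (hb : ∀ f ∈ F, |M.affineBias k a f| ≤ b) :
    M.rmseCriterion F δ s ≤ b ^ 2 + M.sd k ^ 2 := by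
  have hb0 : 0 ≤ b := (abs_nonneg _).trans (hb f h.1)
  have hsd := M.sd_nonneg k
  refine le_of_forall_le_add_mul (c := 2 * b + 2 * M.sd k + 2) fun ε hε hε1 => ?_
  obtain ⟨δ', hδ', s', hs', hs0, hsτ, hB0, hB⟩ :=
    h.exists_superdiff_le hF hδ hb (lt_add_of_pos_right _ hε) hε
  refine (hmin δ' hδ' s' hs').trans ?_
  have h1 : ((M.modulus F δ' - δ' * s') / 2) ^ 2 ≤ (b + ε) ^ 2 := by gcongr
  have h2 : s' ^ 2 ≤ (M.sd k + ε) ^ 2 := by gcongr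
  have h3 : ε * ε ≤ ε * 1 := by gcongr
  unfold rmseCriterion
  linarith

theorem AttainsModulus.worstRMSE_le (hF : Convex ℝ F) (hδ : 0 < δ)
    (h : M.AttainsModulus F δ f g) (hs : s ∈ M.superdiff F δ)
    (hmin : ∀ δ' : ℝ, 0 < δ' → ∀ s' ∈ M.superdiff F δ',
      M.rmseCriterion F δ s ≤ M.rmseCriterion F δ' s') (k : Fin n → ℝ) (a : ℝ) :
    M.worstRMSE F (M.optEst δ s f g) ≤ M.worstRMSE F (affineEst k a) := by
  unfold worstRMSE optEst
  simp only [lintegral_sq_affineEst, h.sd_optWeights hF hδ hs]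
  refine ENNReal.rpow_le_rpow ?_ (by norm_num)
  set S := ⨆ f ∈ F, ENNReal.ofReal (M.affineBias k a f ^ 2 + M.sd k ^ 2) with hS
  rcases eq_or_ne S ⊤ with htop | htop
  · rw [htop]; exact le_top
  have hle : ∀ f ∈ F, M.affineBias k a f ^ 2 + M.sd k ^ 2 ≤ S.toReal := fun f' hf' => by
    rw [← ENNReal.ofReal_le_iff_le_toReal htop]
    exact le_iSup₂ (f := fun (e : X × Bool → ℝ) (_ : e ∈ F) =>
      ENNReal.ofReal (M.affineBias k a e ^ 2 + M.sd k ^ 2)) f' hf'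
  have h0 : 0 ≤ S.toReal - M.sd k ^ 2 := by
    have := hle f h.1
    have := sq_nonneg (M.affineBias k a f)
    linarith
  -- The mean squared error is squared bias plus variance, so a finite worst case S leaves S minus
  -- the variance as a bound on the squared bias.
  have h1 := h.rmseCriterion_le hF hδ hmin (k := k) (a := a) (b := √(S.toReal - M.sd k ^ 2))
    fun f' hf' => Real.abs_le_sqrt (by linarith [hle f' hf'])
  rw [Real.sq_sqrt h0] at h1
  refine iSup₂_le fun f' hf' => ?_
  rw [ENNReal.ofReal_le_iff_le_toReal htop]
  have h2 := sq_le_sq.2 ((h.affineBias_abs_le hF hδ hs hf').trans (le_abs_self _))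
  unfold rmseCriterion at h1
  linarith

end TEModel

theorem mainTheorem9 {X : Type*} {n : ℕ} (M : TEModel X n) (F : Set (X × Bool → ℝ))
    (hF : Convex ℝ F) (α : ℝ) (hα0 : 0 < α) (hα1 : α < 1) :
    -- (i) one-sided confidence intervals
    (∀ δ : ℝ, 0 < δ → ∀ s ∈ M.superdiff F δ, ∀ f g : X × Bool → ℝ,
      M.AttainsModulus F δ f g → M.sqDist f g = δ ^ 2 →
      ∃ B : ℝ, M.maxBias F (M.optEst δ s f g) = (B : EReal) ∧
        M.IsLowerCI F α (fun y => M.optEst δ s f g y - B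
          - zQuantile (1 - α) * M.sd (M.optWeights δ s f g)) ∧
        ∀ c : (Fin n → ℝ) → ℝ, M.IsLowerCI F α c →
          M.excessQuantile (stdNormalCDF (δ - zQuantile (1 - α)))
              (fun y => M.optEst δ s f g y - B
                - zQuantile (1 - α) * M.sd (M.optWeights δ s f g)) F
            ≤ M.excessQuantile (stdNormalCDF (δ - zQuantile (1 - α))) c F) ∧
    -- (ii) fixed-length confidence intervals
    (α ≤ 1 / 2 → ∀ δ : ℝ, 0 < δ → ∀ s ∈ M.superdiff F δ,
      (∀ δ' : ℝ, 0 < δ' → ∀ s' ∈ M.superdiff F δ',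
        M.flciCriterion F α δ s ≤ M.flciCriterion F α δ' s') →
      ∀ f g : X × Bool → ℝ, M.AttainsModulus F δ f g →
      ∃ B : ℝ, M.maxBias F (M.optEst δ s f g) = (B : EReal) ∧
        M.IsFLCI F α (M.optEst δ s f g)
          (flciHalfLength α B (M.sd (M.optWeights δ s f g))) ∧
        ∀ (k : Fin n → ℝ) (a χ : ℝ), M.IsFLCI F α (TEModel.affineEst k a) χ →
          flciHalfLength α B (M.sd (M.optWeights δ s f g)) ≤ χ) ∧
    -- (iii) root mean squared error
    (∀ δ : ℝ, 0 < δ → ∀ s ∈ M.superdiff F δ,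
      (∀ δ' : ℝ, 0 < δ' → ∀ s' ∈ M.superdiff F δ',
        M.rmseCriterion F δ s ≤ M.rmseCriterion F δ' s') →
      ∀ f g : X × Bool → ℝ, M.AttainsModulus F δ f g →
      ∀ (k : Fin n → ℝ) (a : ℝ),
        M.worstRMSE F (M.optEst δ s f g) ≤ M.worstRMSE F (TEModel.affineEst k a)) := by
  refine ⟨fun δ hδ s hs f g h hfg => ?_, fun hα δ hδ s hs hmin f g h => ?_,
    fun δ hδ s hs hmin f g h k a => h.worstRMSE_le hF hδ hs hmin k a⟩
  · exact ⟨_, h.maxBias_eq hF hδ hs, h.isLowerCI hF hα0 hα1 hδ hs, fun c hc =>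
      (h.excessQuantile_le hF hδ hs _).trans (h.le_excessQuantile hF hα0 hα1 hδ hfg hc)⟩
  · refine ⟨_, h.maxBias_eq hF hδ hs, h.isFLCI hF hα0 hα1 hδ hs, fun k a χ hk => ?_⟩
    have h1 := h.halfBias_nonneg hF hδ hs
    rw [h.sd_optWeights hF hδ hs, ← TEModel.flciCriterion_eq α (by linarith)]
    exact h.flciCriterion_le hF hα0 hα hδ hmin hk
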